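/- Let $\|\cdot\|$ be a norm on $\mathbb{R}^d$, write $B_r(0)=\{x:\|x\|<r\}$, and let $\mathcal{F}$ be a family of measurable functions $\rho:\mathbb{R}^d\to\mathbb{R}$ for which there are constants $\alpha\ge 0$ and $\beta,\gamma,r>0$ such that every $\rho\in\mathcal{F}$ satisfies: 1. $|\rho(x)-\rho(y)|\le\alpha\|x-y\|$ for all $x,y\in B_r(0)$; 2. for every $x\in B_r(0)\setminus\{0\}$ the function $f(\lambda)=\rho(\lambda x)$ is differentiable on $(0,1)$ with $f'(\lambda)\ge\beta\|x\|$ for all $\lambda\in(0,1)$; 3. $\rho(x)\ge\gamma$ whenever $\|x\|\ge r$; 4. $\rho(x)=\rho(-x)$ for all $x\in\mathbb{R}^d$; 5. $\rho(0)=0$. Let $(k_n)$ be a sequence of natural numbers with $k_n\to\infty$ and $k_n/n\to0$. For a sequence $(\rho_n)$ of random functions, the $k$-NN rule with distances $\rho_n$ is the following: given a labelled sample $D_n=((X_1,Y_1),\dots,(X_n,Y_n))$ in $\mathbb{R}^d\times\{0,1\}$ and independent tie-breakers $U_1,\dots,U_n$ uniform on $[0,1]$, the point $X_i$ is a $k_n$-nearest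 neighbour of $x$ if fewer than $k_n$ indices $j$ satisfy $\rho_n(x-X_j)<\rho_n(x-X_i)$, or $\rho_n(x-X_j)=\rho_n(x-X_i)$ and $U_j>U_i$; the rule assigns to $x$ the label $1$ if $\frac1{k_n}\sum_i Y_i\mathbf 1\{X_i\text{ is a }k_n\text{-nearest neighbour of }x\}\ge\frac12$, and $0$ otherwise. The rule is universally consistent if for every probability measure $\mu$ on $\mathbb{R}^d\times\{0,1\}$, when $(X_1,Y_1),(X_2,Y_2),\dots$ and the query $(X,Y)$ are iid with law $\mu$, the conditional probability, given $D_n$, that the label assigned to $X$ differs from $Y$ converges in probability, as $n\to\infty$, to the Bayes error $\inf_f\mu\{(x,y):f(x)\ne y\}$, the infimum being over all Borel $f:\mathbb{R}^d\to\{0,1\}$. Then for every sequence $(\rho_n)$ of random functions (that is, random elements depending jointly measurably on the randomness and on the point) with values in $\mathcal{F}$ such that, for each $n$, $\rho_n$ is independent of the sample, the query and the tie-breakers, the $k$-NN rule with distances $\rho_n$ is universally consistent. The same holds for every sequence of such random functions with values in a family $\mathcal{G}$ each of whose members has the form $g=h\circ f$ with $f\in\mathcal{F}$ and $h$ strictly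 increasing on the range of $f$. -/

import Mathlib

open MeasureTheory ProbabilityTheory Filter Topology Set

universe u v w

noncomputable section

/-- The Bayes error of a distribution `μ` on `E × {0, 1}`: the infimum of the misclassification
errors `μ {(x, y) | f x ≠ y}` over all Borel classifiers `f : E → {0, 1}`. -/
def bayesError {E : Type u} [MeasurableSpace E] (μ : Measure (E × Fin 2)) : ℝ :=
  ⨅ f : {f : E → Fin 2 // Measurable f}, μ.real {p : E × Fin 2 | f.1 p.1 ≠ p.2}

/-- A (randomized) binary learning rule on `E`: `L n D a x` is the label given to the query point
`x` from the labelled sample `D` of size `n` when the auxiliary random variable (tie-breakers and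
any further randomness used by the rule) takes the value `a : A n`. -/
abbrev LearningRule (E : Type u) (A : ℕ → Type v) : Type (max u v) :=
  (n : ℕ) → (Fin n → E × Fin 2) → A n → E → Fin 2

/-- `L` is (weakly) consistent for the distribution `μ`, the auxiliary random variable at sample
size `n` having law `ν n`. For any iid labelled points `Z 0, Z 1, …` with law `μ`, an independent
query with label `Q = (X, Y)` of law `μ`, and auxiliary random variables `W n` of law `ν n` that are
independent of the sample `D_n = (Z 0, …, Z (n - 1))` and the query, the error probability
`P (L n D_n (W n) X ≠ Y | D_n)` converges in probability to the Bayes error. -/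
def IsConsistent {E : Type u} [MeasurableSpace E] {A : ℕ → Type v} [∀ n, MeasurableSpace (A n)]
    (ν : ∀ n, Measure (A n)) (L : LearningRule E A) (μ : Measure (E × Fin 2)) : Prop :=
  ∀ (Ω : Type w) [MeasurableSpace Ω] (P : Measure Ω) [IsProbabilityMeasure P]
    (Z : ℕ → Ω → E × Fin 2) (Q : Ω → E × Fin 2) (W : ∀ n, Ω → A n),
    (∀ i, Measurable (Z i)) → (∀ i, P.map (Z i) = μ) → iIndepFun Z P →
    Measurable Q → P.map Q = μ →
    (∀ n, IndepFun (fun ω (i : Fin n) => Z i ω) Q P) →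
    (∀ n, Measurable (W n)) → (∀ n, P.map (W n) = ν n) →
    (∀ n, IndepFun (W n) (fun ω => ((fun i : Fin n => Z i ω), Q ω)) P) →
    TendstoInMeasure P
      (fun n => P⟦{ω | L n (fun i : Fin n => Z i ω) (W n ω) (Q ω).1 ≠ (Q ω).2} |
        MeasurableSpace.comap (fun ω (i : Fin n) => Z i ω) inferInstance⟧)
      atTop (fun _ => bayesError μ)

/-- `L` is universally consistent: it is a Borel learning rule and it is consistent for every
probability distribution on `E × {0, 1}`. -/
def IsUniversallyConsistent {E : Type u} [MeasurableSpace E] {A : ℕ → Type v}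
    [∀ n, MeasurableSpace (A n)] (ν : ∀ n, Measure (A n)) (L : LearningRule E A) : Prop :=
  (∀ n, Measurable fun p : (Fin n → E × Fin 2) × A n × E => L n p.1 p.2.1 p.2.2) ∧
    ∀ μ : Measure (E × Fin 2), IsProbabilityMeasure μ → IsConsistent.{u, v, w} ν L μ

open Classical in
/-- `X i` is one of the `k` nearest neighbours of the query `x` among `X 0, …, X (n - 1)` for the
distance `ρ (x - y)`: fewer than `k` sample points come before it, where distance ties are broken
in favour of the larger tie-breaker. -/
def IsKNearest {E : Type u} [Sub E] (ρ : E → ℝ) (k : ℕ) {n : ℕ} (X : Fin n → E) (U : Fin n → ℝ)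
    (x : E) (i : Fin n) : Prop :=
  (Finset.univ.filter fun j : Fin n =>
    ρ (x - X j) < ρ (x - X i) ∨ (ρ (x - X j) = ρ (x - X i) ∧ U i < U j)).card < k

open Classical in
/-- The `k`-NN weights: `1 / k` on the `k` nearest neighbours of `x` and `0` on the others. -/
def knnWeight {E : Type u} [Sub E] (ρ : E → ℝ) (k : ℕ) {n : ℕ} (X : Fin n → E) (U : Fin n → ℝ)
    (x : E) (i : Fin n) : ℝ :=
  if IsKNearest ρ k X U x i then 1 / (k : ℝ) else 0

/-- The `k`-NN estimate of the regression function. -/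
def knnEstimate {E : Type u} [Sub E] (ρ : E → ℝ) (k : ℕ) {n : ℕ} (D : Fin n → E × Fin 2)
    (U : Fin n → ℝ) (x : E) : ℝ :=
  ∑ i : Fin n, ((D i).2 : ℝ) * knnWeight ρ k (fun j => (D j).1) U x i

/-- The `k`-NN classifier for the distance `ρ (x - y)`; voting ties give the label `1`. -/
def knnClassify {E : Type u} [Sub E] (ρ : E → ℝ) (k : ℕ) {n : ℕ} (D : Fin n → E × Fin 2)
    (U : Fin n → ℝ) (x : E) : Fin 2 :=
  if 1 / 2 ≤ knnEstimate ρ k D U x then 1 else 0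

/-- The `k`-NN learning rule with a sequence of random distances. At sample size `n` the auxiliary
variable is `(U, t)`: `U` is the vector of tie-breakers and `ρ n t` the random distance function. -/
def knnRule {E : Type u} [Sub E] {T : ℕ → Type v} (k : ℕ → ℕ) (ρ : ∀ n, T n → E → ℝ) :
    LearningRule E (fun n => (Fin n → ℝ) × T n) :=
  fun n D a x => knnClassify (ρ n a.2) (k n) D a.1 x

/-- The law of the auxiliary variable of the `k`-NN rule: `n` independent tie-breakers, uniform on
`[0, 1]`, and an independent random parameter of law `τ n` (which selects the distance). -/
def knnAuxLaw {T : ℕ → Type v} [∀ n, MeasurableSpace (T n)] (τ : ∀ n, Measure (T n)) (n : ℕ) :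
    Measure ((Fin n → ℝ) × T n) :=
  (Measure.pi fun _ : Fin n => (volume : Measure ℝ).restrict (Icc 0 1)).prod (τ n)

/-- `ρ n`, seen as a random function on the probability space `(T n, τ n)`, is for each `n` a random
element of the family `𝓕`: it is jointly measurable and takes its values in `𝓕`. -/
structure IsRandomSequenceIn {E : Type u} [MeasurableSpace E] (𝓕 : Set (E → ℝ)) {T : ℕ → Type v}
    [∀ n, MeasurableSpace (T n)] (τ : ∀ n, Measure (T n)) (ρ : ∀ n, T n → E → ℝ) : Prop where
  isProbabilityMeasure : ∀ n, IsProbabilityMeasure (τ n)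
  measurable : ∀ n, Measurable fun p : T n × E => ρ n p.1 p.2
  mem : ∀ n t, ρ n t ∈ 𝓕

/-- The conditions on a single distance function, with constants `α, β, γ` and radius `r`. -/
structure IsLocallyLipschitzDistance {E : Type u} [NormedAddCommGroup E] [NormedSpace ℝ E]
    [MeasurableSpace E] (α β γ r : ℝ) (ρ : E → ℝ) : Prop where
  measurable : Measurable ρ
  lipschitz : ∀ x ∈ Metric.ball (0 : E) r, ∀ y ∈ Metric.ball (0 : E) r,
    |ρ x - ρ y| ≤ α * ‖x - y‖
  radial : ∀ x ∈ Metric.ball (0 : E) r, x ≠ 0 → ∀ l ∈ Ioo (0 : ℝ) 1,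
    DifferentiableAt ℝ (fun s : ℝ => ρ (s • x)) l ∧
      β * ‖x‖ ≤ deriv (fun s : ℝ => ρ (s • x)) l
  lower : ∀ x : E, r ≤ ‖x‖ → γ ≤ ρ x
  symm : ∀ x : E, ρ x = ρ (-x)
  zero : ρ 0 = 0

end

/-!
The proof follows Stone's theorem on local averaging rules. The conditional error given the sample
is almost surely at least the Bayes error, so convergence in probability follows from convergence of
the expected error (`isConsistent_of_forall_eventually_le`), and the excess error of a plug-in rule
is at most twice the `L¹` distance between the estimate `∑ W i * Y i` and the regression function
`η` (`measureReal_plugIn_ne_le`). This distance is bounded for a fixed distance `ρ` and fixed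
distinct tie-breakers, uniformly in both (`eventually_integral_abs_knnEstimate_sub_le`), so the
randomness of `ρ` and of the tie-breakers is integrated out at the end. It has three parts.

* The centred labels `Y i - η (X i)` are orthogonal given the points, so their average over `k`
  neighbours has second moment at most `1 / k` (`integral_sq_sum_centered_le`).
* Neighbours at norm distance at least `a` from the query occur only if fewer than `k` sample points
  lie in a certain small ball around it (`IsKNearest.card_lt`). As `k n / n → 0`, the probability of
  this tends to `0` (`tendsto_measureReal_card_near_lt`).
* At near neighbours `η` is compared with a continuous function `g`, and the average of `|η - g|`
  over these neighbours is controlled by Stone's lemma (`integral_sum_near_le`): after exchanging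
  the query with the `i`-th point, one has to count the sample points which have a given point among
  their `k` nearest neighbours, and there are at most a constant times `k` of them
  (`card_isKNearest_update_le`).

Only two properties of `ρ` enter, collected in `IsConeMonotone`: for points in a narrow cone with
apex `x`, the ones nearer to `x` are `ρ`-closer to the farther ones than `x` is; and points of small
norm are `ρ`-closer to the origin than points of large norm. The Lipschitz bound, the lower bound on
the radial derivative and the lower bound away from the origin give both, with constants that depend
only on the family (`IsLocallyLipschitzDistance.isConeMonotone`). Both properties are about the
order of the values of `ρ` only, so they pass to `h ∘ ρ` for strictly increasing `h`.
-/

/-! ### Order properties of the distances -/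

/-- The properties of a distance `ρ` that depend only on the way in which `ρ` orders the points.
`cone`: if `u` is no longer than `v` and its direction is within `ε` of that of `v`, then `v` is
`ρ`-closer to `u` than to the origin (for `‖v‖ < r`). `sep`: points of norm less than `δ a` are
`ρ`-closer to the origin than points of norm at least `a`. -/
structure IsConeMonotone {E : Type u} [NormedAddCommGroup E] [NormedSpace ℝ E]
    (r ε : ℝ) (δ : ℝ → ℝ) (ρ : E → ℝ) : Prop where
  cone : ∀ u v : E, u ≠ 0 → ‖u‖ ≤ ‖v‖ → ‖v‖ < r →
    ‖‖u‖⁻¹ • u - ‖v‖⁻¹ • v‖ < ε → ρ (v - u) < ρ v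
  sep : ∀ a > 0, ∀ x y : E, ‖x‖ < δ a → a ≤ ‖y‖ → ρ x < ρ y

lemma IsConeMonotone.comp {E : Type u} [NormedAddCommGroup E] [NormedSpace ℝ E]
    {r ε : ℝ} {δ : ℝ → ℝ} {ρ : E → ℝ} (hρ : IsConeMonotone r ε δ ρ) {h : ℝ → ℝ}
    (hh : StrictMonoOn h (range ρ)) : IsConeMonotone r ε δ (h ∘ ρ) where
  cone u v hu huv hv hε := hh (mem_range_self _) (mem_range_self _) (hρ.cone u v hu huv hv hε)
  sep a ha x y hx hy := hh (mem_range_self _) (mem_range_self _) (hρ.sep a ha x y hx hy)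

lemma IsLocallyLipschitzDistance.radial_le {E : Type u} [NormedAddCommGroup E] [NormedSpace ℝ E]
    [MeasurableSpace E] {α β γ r : ℝ} {ρ : E → ℝ} (hρ : IsLocallyLipschitzDistance α β γ r ρ)
    {x : E} (hx : ‖x‖ < r) {s : ℝ} (hs0 : 0 ≤ s) (hs1 : s ≤ 1) :
    β * ‖x‖ * (1 - s) ≤ ρ x - ρ (s • x) := by
  rcases eq_or_ne x 0 with rfl | hx0
  · simp
  have hmem : ∀ t ∈ Icc (0 : ℝ) 1, t • x ∈ Metric.ball (0 : E) r := fun t ht => by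
    rw [mem_ball_zero_iff, norm_smul, Real.norm_of_nonneg ht.1]
    exact (mul_le_of_le_one_left (norm_nonneg x) ht.2).trans_lt hx
  have hcont : ContinuousOn (fun t : ℝ => ρ (t • x)) (Icc 0 1) := by
    refine (LipschitzOnWith.of_dist_le_mul (K := (|α| * ‖x‖).toNNReal) ?_).continuousOn
    intro t ht t' ht'
    rw [Real.coe_toNNReal _ (by positivity), Real.dist_eq, Real.dist_eq]
    refine (hρ.lipschitz _ (hmem t ht) _ (hmem t' ht')).trans ?_
    rw [← sub_smul, norm_smul, Real.norm_eq_abs]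
    calc α * (|t - t'| * ‖x‖) ≤ |α| * (|t - t'| * ‖x‖) := by gcongr; exact le_abs_self α
      _ = |α| * ‖x‖ * |t - t'| := by ring
  have hxb : x ∈ Metric.ball (0 : E) r := mem_ball_zero_iff.2 hx
  have := (convex_Icc (0 : ℝ) 1).mul_sub_le_image_sub_of_le_deriv (C := β * ‖x‖) hcont
    (by
      rw [interior_Icc]
      exact fun t ht => (hρ.radial x hxb hx0 t ht).1.differentiableWithinAt)
    (by
      rw [interior_Icc]
      exact fun t ht => (hρ.radial x hxb hx0 t ht).2)
    s ⟨hs0, hs1⟩ 1 ⟨zero_le_one, le_rfl⟩ hs1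
  simpa using this

/-- Moving from `v` along the ray to `(1 - ‖u‖ / ‖v‖) • v` lowers `ρ` by at least `β * ‖u‖`, and
the Lipschitz condition bounds the error made in replacing that point by `v - u` by
`α * ε * ‖u‖`. -/
lemma IsLocallyLipschitzDistance.isConeMonotone {E : Type u} [NormedAddCommGroup E]
    [NormedSpace ℝ E] [MeasurableSpace E] {α β γ r : ℝ} (hα : 0 ≤ α) (hβ : 0 < β)
    {ρ : E → ℝ} (hρ : IsLocallyLipschitzDistance α β γ r ρ) :
    IsConeMonotone r (min 1 (β / (α + 1)))
      (fun a => min r (min (β * a) γ / (α + 1))) ρ where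
  cone u v hu huv hv hε := by
    have hu' : 0 < ‖u‖ := norm_pos_iff.2 hu
    have hv' : 0 < ‖v‖ := hu'.trans_le huv
    set s : ℝ := 1 - ‖u‖ / ‖v‖ with hs
    have hq1 : ‖u‖ / ‖v‖ ≤ 1 := (div_le_one hv').2 huv
    have hq0 : 0 ≤ ‖u‖ / ‖v‖ := by positivity
    have hdiff : (v - u) - s • v = -(‖u‖ • (‖u‖⁻¹ • u - ‖v‖⁻¹ • v)) := by
      rw [hs, smul_sub, smul_smul, smul_smul, mul_inv_cancel₀ hu'.ne', sub_smul, one_smul,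
        one_smul, div_eq_mul_inv]
      abel
    have hnorm : ‖(v - u) - s • v‖ ≤ min 1 (β / (α + 1)) * ‖u‖ := by
      rw [hdiff, norm_neg, norm_smul, norm_norm, mul_comm]
      gcongr
    have hsv : ‖s • v‖ = ‖v‖ - ‖u‖ := by
      rw [norm_smul, Real.norm_of_nonneg (by linarith), hs]
      field_simp
    have hvu : v - u ∈ Metric.ball (0 : E) r := by
      rw [mem_ball_zero_iff]
      have h1 : ‖v - u‖ ≤ ‖(v - u) - s • v‖ + ‖s • v‖ := by
        simpa using norm_add_le ((v - u) - s • v) (s • v)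
      have h2 : min 1 (β / (α + 1)) * ‖u‖ ≤ 1 * ‖u‖ := by gcongr; exact min_le_left _ _
      linarith
    have hsvr : s • v ∈ Metric.ball (0 : E) r := by
      rw [mem_ball_zero_iff, hsv]; linarith
    have h1 := (le_abs_self _).trans (hρ.lipschitz _ hvu _ hsvr)
    have h2 := hρ.radial_le hv (s := s) (by linarith) (by linarith)
    have h3 : β * ‖v‖ * (1 - s) = β * ‖u‖ := by rw [hs]; field_simp; ring
    have h4 : α * ‖(v - u) - s • v‖ ≤ α * (β / (α + 1)) * ‖u‖ := by
      rw [mul_assoc]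
      refine mul_le_mul_of_nonneg_left (hnorm.trans ?_) hα
      gcongr
      exact min_le_right _ _
    have h5 : α * (β / (α + 1)) < β := by
      rw [mul_div_assoc', div_lt_iff₀ (by positivity)]; linarith
    have h6 := mul_lt_mul_of_pos_right h5 hu'
    linarith
  sep a ha x y hx hy := by
    have hxr : ‖x‖ < r := hx.trans_le (min_le_left _ _)
    have hx2 : ‖x‖ < min (β * a) γ / (α + 1) := hx.trans_le (min_le_right _ _)
    rw [lt_div_iff₀ (by positivity)] at hx2
    have h0 : ρ x ≤ α * ‖x‖ := by
      have := hρ.lipschitz x (mem_ball_zero_iff.2 hxr) 0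
        (Metric.mem_ball_self ((norm_nonneg x).trans_lt hxr))
      rw [hρ.zero, sub_zero, sub_zero] at this
      exact (le_abs_self _).trans this
    have h1 : ρ x ≤ ‖x‖ * (α + 1) := by nlinarith [norm_nonneg x]
    refine (h1.trans_lt hx2).trans_le ?_
    rcases lt_or_ge ‖y‖ r with hyr | hyr
    · have h2 := hρ.radial_le hyr (s := 0) le_rfl zero_le_one
      rw [zero_smul, hρ.zero, sub_zero, sub_zero, mul_one] at h2
      exact (min_le_left _ _).trans (le_trans (by gcongr) h2)
    · exact (min_le_right _ _).trans (hρ.lower y hyr)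

/-! ### Counting nearest neighbours -/

open Classical in
/-- Listing the points by distance, and by decreasing tie-breaker among points at the same distance,
is a bijection with the ranks `0, …, n - 1`, and the nearest neighbours are the points of rank less
than `k`. -/
lemma card_isKNearest {E : Type u} [Sub E] (ρ : E → ℝ) {k n : ℕ} (hkn : k ≤ n)
    (X : Fin n → E) {U : Fin n → ℝ} (hU : Function.Injective U) (x : E) :
    (Finset.univ.filter fun i => IsKNearest ρ k X U x i).card = k := by
  let pre : Fin n → Finset (Fin n) := fun i => Finset.univ.filter fun j : Fin n =>
    ρ (x - X j) < ρ (x - X i) ∨ (ρ (x - X j) = ρ (x - X i) ∧ U i < U j)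
  have hself : ∀ i, i ∉ pre i := fun i => by simp [pre]
  have hlt : ∀ i, (pre i).card < n := fun i => by
    have hne : pre i ≠ Finset.univ := fun h => hself i (h.symm ▸ Finset.mem_univ i)
    simpa using Finset.card_lt_card (Finset.ssubset_univ_iff.2 hne)
  have hmono : ∀ i j, i ∈ pre j → (pre i).card < (pre j).card := fun i j hij => by
    refine Finset.card_lt_card ⟨fun l hl => ?_, fun h => hself i (h hij)⟩
    simp only [pre, Finset.mem_filter, Finset.mem_univ, true_and] at hij hl ⊢
    rcases hij with hij | ⟨hij, hij'⟩ <;> rcases hl with hl | ⟨hl, hl'⟩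
    · exact Or.inl (hl.trans hij)
    · exact Or.inl (hl ▸ hij)
    · exact Or.inl (hij ▸ hl)
    · exact Or.inr ⟨hl.trans hij, hij'.trans hl'⟩
  have hinj : Function.Injective fun i => (⟨(pre i).card, hlt i⟩ : Fin n) := fun i j hij => by
    by_contra hne
    have hij' : (pre i).card = (pre j).card := congrArg Fin.val hij
    have htot : i ∈ pre j ∨ j ∈ pre i := by
      simp only [pre, Finset.mem_filter, Finset.mem_univ, true_and]
      rcases lt_trichotomy (ρ (x - X i)) (ρ (x - X j)) with h | h | h
      · exact Or.inl (Or.inl h)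
      · rcases lt_or_gt_of_ne (hU.ne hne) with h' | h'
        · exact Or.inr (Or.inr ⟨h.symm, h'⟩)
        · exact Or.inl (Or.inr ⟨h, h'⟩)
      · exact Or.inr (Or.inl h)
    rcases htot with h | h
    · exact (hmono i j h).ne hij'
    · exact (hmono j i h).ne hij'.symm
  have hbij := Finite.injective_iff_bijective.1 hinj
  calc (Finset.univ.filter fun i => IsKNearest ρ k X U x i).card
      = (Finset.univ.filter fun i : Fin n => (i : ℕ) < k).card := by
        refine Finset.card_bijective _ hbij fun i => ?_
        simp only [Finset.mem_filter, Finset.mem_univ, true_and]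
        exact Iff.rfl
    _ = k := by
        rw [Fin.card_filter_val_lt]; exact min_eq_right hkn

lemma knnWeight_nonneg {E : Type u} [Sub E] (ρ : E → ℝ) (k : ℕ) {n : ℕ}
    (X : Fin n → E) (U : Fin n → ℝ) (x : E) (i : Fin n) : 0 ≤ knnWeight ρ k X U x i := by
  rw [knnWeight]; split_ifs <;> positivity

lemma knnWeight_le {E : Type u} [Sub E] (ρ : E → ℝ) (k : ℕ) {n : ℕ}
    (X : Fin n → E) (U : Fin n → ℝ) (x : E) (i : Fin n) : knnWeight ρ k X U x i ≤ 1 / k := by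
  rw [knnWeight]; split_ifs <;> [exact le_rfl; positivity]

lemma sum_knnWeight {E : Type u} [Sub E] (ρ : E → ℝ) {k n : ℕ} (hk : 0 < k) (hkn : k ≤ n)
    (X : Fin n → E) {U : Fin n → ℝ} (hU : Function.Injective U) (x : E) :
    ∑ i, knnWeight ρ k X U x i = 1 := by
  classical
  simp only [knnWeight]
  rw [← Finset.sum_filter, Finset.sum_const]
  have := card_isKNearest ρ hkn X hU x
  rw [nsmul_eq_mul, mul_one_div]
  convert div_self (Nat.cast_ne_zero.2 hk.ne' : (k : ℝ) ≠ 0) using 3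

open Classical in
/-- If a nearest neighbour is at distance at least `a`, fewer than `k` sample points are within
distance `δ a` of the query. -/
lemma IsKNearest.card_lt {E : Type u} [NormedAddCommGroup E] [NormedSpace ℝ E]
    {r ε : ℝ} {δ : ℝ → ℝ} {ρ : E → ℝ} (hρ : IsConeMonotone r ε δ ρ) {k n : ℕ} {X : Fin n → E}
    {U : Fin n → ℝ} {x : E} {i : Fin n} (hi : IsKNearest ρ k X U x i) {a : ℝ} (ha : 0 < a)
    (hai : a ≤ ‖x - X i‖) :
    (Finset.univ.filter fun j : Fin n => ‖x - X j‖ < δ a).card < k := by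
  refine lt_of_le_of_lt (Finset.card_le_card fun j hj => ?_) hi
  simp only [Finset.mem_filter, Finset.mem_univ, true_and] at hj ⊢
  exact Or.inl (hρ.sep a ha _ _ hj hai)

/-- Unit vectors are covered by finitely many balls of radius `ε / 2`. -/
lemma exists_finset_directions (E : Type u) [NormedAddCommGroup E] [NormedSpace ℝ E]
    [FiniteDimensional ℝ E] {ε : ℝ} (hε : 0 < ε) :
    ∃ C : Finset E, ∀ u : E, u ≠ 0 → ∃ c ∈ C, ‖‖u‖⁻¹ • u - c‖ < ε / 2 := by
  obtain ⟨t, -, htf, ht⟩ := (isCompact_sphere (0 : E) 1).finite_cover_balls (half_pos hε)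
  refine ⟨htf.toFinset, fun u hu => ?_⟩
  have hus : ‖u‖⁻¹ • u ∈ Metric.sphere (0 : E) 1 := by
    rw [mem_sphere_zero_iff_norm, norm_smul, norm_inv, norm_norm,
      inv_mul_cancel₀ (norm_ne_zero_iff.2 hu)]
  obtain ⟨c, hc, hc'⟩ := mem_iUnion₂.1 (ht hus)
  exact ⟨c, htf.mem_toFinset.2 hc, by rwa [Metric.mem_ball, dist_eq_norm] at hc'⟩

open Classical in
/-- The geometric half of Stone's lemma. A point `x` that replaces one sample point after the other
is a nearest neighbour of the point it replaces for at most `(N + 1) * k` of those within distance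
`r`, where `N` is a number of narrow cones that cover the space: within one cone with apex `x`, the
replaced point farthest from `x` has all the others strictly closer to it than `x`. Sample points
that coincide with `x` are ordered by their tie-breakers. -/
lemma card_isKNearest_update_le {E : Type u} [NormedAddCommGroup E] [NormedSpace ℝ E]
    {r ε : ℝ} {δ : ℝ → ℝ} {ρ : E → ℝ} (hρ : IsConeMonotone r ε δ ρ) {C : Finset E}
    (hC : ∀ u : E, u ≠ 0 → ∃ c ∈ C, ‖‖u‖⁻¹ • u - c‖ < ε / 2)
    (k : ℕ) {n : ℕ} (X : Fin n → E) {U : Fin n → ℝ} (hU : Function.Injective U) (x : E) :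
    (Finset.univ.filter fun i : Fin n => ‖X i - x‖ < r ∧
      IsKNearest ρ k (Function.update X i x) U (X i) i).card ≤ (C.card + 1) * k := by
  set S := Finset.univ.filter fun i : Fin n => ‖X i - x‖ < r ∧
      IsKNearest ρ k (Function.update X i x) U (X i) i with hS
  let S0 := S.filter fun i => X i = x
  let Sc : E → Finset (Fin n) := fun c =>
    S.filter fun i => X i ≠ x ∧ ‖‖X i - x‖⁻¹ • (X i - x) - c‖ < ε / 2
  have hsub : S ⊆ S0 ∪ C.biUnion Sc := fun i hi => by
    by_cases h : X i = x
    · exact Finset.mem_union_left _ (Finset.mem_filter.2 ⟨hi, h⟩)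
    · obtain ⟨c, hc, hc'⟩ := hC (X i - x) (sub_ne_zero.2 h)
      exact Finset.mem_union_right _
        (Finset.mem_biUnion.2 ⟨c, hc, Finset.mem_filter.2 ⟨hi, h, hc'⟩⟩)
  -- A set of replaced points has at most `k` elements if one of them has all the others before `x`
  -- in its list of neighbours.
  have key : ∀ (A : Finset (Fin n)), A ⊆ S → (∀ hA : A.Nonempty, ∃ i ∈ A, ∀ j ∈ A, j ≠ i →
      ρ (X i - X j) < ρ (X i - x) ∨ (ρ (X i - X j) = ρ (X i - x) ∧ U i < U j)) → A.card ≤ k := by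
    intro A hAS hA
    rcases A.eq_empty_or_nonempty with rfl | hne
    · simp
    obtain ⟨i, hi, hij⟩ := hA hne
    have hik := (Finset.mem_filter.1 (hAS hi)).2.2
    have hle : (A.erase i).card < k := by
      refine lt_of_le_of_lt (Finset.card_le_card fun j hj => ?_) hik
      obtain ⟨hji, hj⟩ := Finset.mem_erase.1 hj
      simpa [Function.update_of_ne hji] using hij j hj hji
    rw [Finset.card_erase_of_mem hi] at hle
    omega
  have h0 : S0.card ≤ k := key S0 (Finset.filter_subset _ _) fun hne => by
    obtain ⟨i, hi, hmin⟩ := S0.exists_min_image U hne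
    refine ⟨i, hi, fun j hj hji => Or.inr ⟨?_, (hmin j hj).lt_of_ne (hU.ne hji.symm)⟩⟩
    rw [(Finset.mem_filter.1 hj).2]
  have hc : ∀ c ∈ C, (Sc c).card ≤ k := fun c _ =>
      key (Sc c) (Finset.filter_subset _ _) fun hne => by
    obtain ⟨i, hi, hmax⟩ := (Sc c).exists_max_image (fun i => ‖X i - x‖) hne
    refine ⟨i, hi, fun j hj hji => Or.inl ?_⟩
    obtain ⟨hiS, -, hic⟩ := Finset.mem_filter.1 hi
    obtain ⟨hjS, hjx, hjc⟩ := Finset.mem_filter.1 hj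
    have := hρ.cone (X j - x) (X i - x) (sub_ne_zero.2 hjx) (hmax j hj)
      (Finset.mem_filter.1 hiS).2.1 ?_
    · simpa using this
    · rw [norm_sub_rev] at hic
      calc _ ≤ ‖‖X j - x‖⁻¹ • (X j - x) - c‖ + ‖c - ‖X i - x‖⁻¹ • (X i - x)‖ :=
            norm_sub_le_norm_sub_add_norm_sub _ _ _
        _ < ε := by linarith
  calc S.card ≤ (S0 ∪ C.biUnion Sc).card := Finset.card_le_card hsub
    _ ≤ S0.card + (C.biUnion Sc).card := Finset.card_union_le _ _
    _ ≤ k + C.card * k := Nat.add_le_add h0 (Finset.card_biUnion_le_card_mul _ _ _ hc)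
    _ = (C.card + 1) * k := by ring

/-! ### Measurability -/

section Measurability

variable {E : Type u} [NormedAddCommGroup E] [MeasurableSpace E] [MeasurableSub₂ E]
  {S : Type v} [MeasurableSpace S] {n : ℕ} {ρ : S → E → ℝ} {X : S → Fin n → E}
  {U : S → Fin n → ℝ} {x : S → E}

lemma measurableSet_isKNearest (hρ : Measurable (Function.uncurry ρ)) (hX : Measurable X)
    (hU : Measurable U) (hx : Measurable x) (k : ℕ) (i : Fin n) :
    MeasurableSet {s | IsKNearest (ρ s) k (X s) (U s) (x s) i} := by
  classical
  have hd : ∀ j, Measurable fun s => ρ s (x s - X s j) := fun j =>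
    hρ.comp (measurable_id.prodMk (hx.sub (measurable_pi_iff.1 hX j)))
  have hU' := measurable_pi_iff.1 hU
  have hcard : Measurable fun s => (Finset.univ.filter fun j : Fin n =>
      ρ s (x s - X s j) < ρ s (x s - X s i) ∨
        (ρ s (x s - X s j) = ρ s (x s - X s i) ∧ U s i < U s j)).card := by
    simp only [Finset.card_filter]
    refine Finset.measurable_sum _ fun j _ => Measurable.ite ?_ measurable_const measurable_const
    exact (measurableSet_lt (hd j) (hd i)).union
      ((measurableSet_eq_fun (hd j) (hd i)).inter (measurableSet_lt (hU' i) (hU' j)))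
  have := hcard (measurableSet_Iio (a := k))
  convert this using 1
  ext s
  simp only [mem_ofPred_eq, mem_preimage, mem_Iio, IsKNearest]

lemma measurable_knnWeight (hρ : Measurable (Function.uncurry ρ)) (hX : Measurable X)
    (hU : Measurable U) (hx : Measurable x) (k : ℕ) (i : Fin n) :
    Measurable fun s => knnWeight (ρ s) k (X s) (U s) (x s) i := by
  classical
  simp only [knnWeight]
  exact Measurable.ite (measurableSet_isKNearest hρ hX hU hx k i) measurable_const measurable_const

lemma measurable_knnEstimate {D : S → Fin n → E × Fin 2} (hρ : Measurable (Function.uncurry ρ))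
    (hD : Measurable D) (hU : Measurable U) (hx : Measurable x) (k : ℕ) :
    Measurable fun s => knnEstimate (ρ s) k (D s) (U s) (x s) := by
  have hD' := measurable_pi_iff.1 hD
  refine Finset.measurable_sum _ fun i _ => Measurable.mul ?_ ?_
  · exact (Measurable.of_discrete (f := fun y : Fin 2 => (y : ℝ))).comp (hD' i).snd
  · exact measurable_knnWeight hρ (measurable_pi_iff.2 fun j => (hD' j).fst) hU hx k i

lemma measurable_knnClassify {D : S → Fin n → E × Fin 2} (hρ : Measurable (Function.uncurry ρ))
    (hD : Measurable D) (hU : Measurable U) (hx : Measurable x) (k : ℕ) :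
    Measurable fun s => knnClassify (ρ s) k (D s) (U s) (x s) :=
  Measurable.ite (measurableSet_le measurable_const (measurable_knnEstimate hρ hD hU hx k))
    measurable_const measurable_const

end Measurability

/-! ### Resampling one coordinate of an iid sample -/

section Resampling

variable {Z : Type*} [MeasurableSpace Z] {ι : Type*} [Fintype ι] [DecidableEq ι]
  (μ : Measure Z) [IsProbabilityMeasure μ]

/-- An iid sample and an independent point of the same law are exchangeable. -/
lemma measurePreserving_swap_update (i : ι) :
    MeasurePreserving (fun p : (ι → Z) × Z => (Function.update p.1 i p.2, p.1 i))
      ((Measure.pi fun _ => μ).prod μ) ((Measure.pi fun _ => μ).prod μ) := by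
  have hmeas : Measurable (fun p : (ι → Z) × Z => (Function.update p.1 i p.2, p.1 i)) := by
    refine Measurable.prodMk (measurable_pi_iff.2 fun j => ?_) (by fun_prop)
    rcases eq_or_ne j i with rfl | hj
    · simpa using measurable_snd
    · simpa [Function.update_of_ne hj, Function.comp_def] using
        (measurable_pi_apply (X := fun _ : ι => Z) j).comp measurable_fst
  refine ⟨hmeas, ?_⟩
  symm
  refine Measure.prod_eq_generateFrom (C := pi univ '' pi univ fun _ : ι => {s | MeasurableSet s})
    (D := {s | MeasurableSet s}) generateFrom_pi MeasurableSpace.generateFrom_measurableSet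
    isPiSystem_pi MeasurableSpace.isPiSystem_measurableSet
    ⟨fun _ => univ, fun _ => ⟨fun _ => univ, fun _ _ => MeasurableSet.univ, pi_univ _⟩,
      fun _ => measure_lt_top _ _, iUnion_const _⟩
    μ.toFiniteSpanningSetsIn ?_
  rintro _ ⟨s, hs, rfl⟩ t ht
  have hs' : ∀ j, MeasurableSet (s j) := fun j => hs j (mem_univ j)
  have hpre : (fun p : (ι → Z) × Z => (Function.update p.1 i p.2, p.1 i)) ⁻¹' (pi univ s ×ˢ t) =
      pi univ (Function.update s i t) ×ˢ s i := by
    ext ⟨D, z⟩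
    simp only [mem_preimage, mem_prod, Set.mem_pi, mem_univ, true_imp_iff]
    constructor
    · rintro ⟨h1, h2⟩
      refine ⟨fun j => ?_, by simpa using h1 i⟩
      rcases eq_or_ne j i with rfl | hj
      · simpa using h2
      · simpa [Function.update_of_ne hj] using h1 j
    · rintro ⟨h1, h2⟩
      refine ⟨fun j => ?_, by simpa using h1 i⟩
      rcases eq_or_ne j i with rfl | hj
      · simpa using h2
      · simpa [Function.update_of_ne hj] using h1 j
  rw [Measure.map_apply hmeas ((MeasurableSet.univ_pi hs').prod ht), hpre, Measure.prod_prod,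
    Measure.pi_pi, Measure.pi_pi, ← Finset.mul_prod_erase _ _ (Finset.mem_univ i),
    ← Finset.mul_prod_erase (a := i) _ (fun j => μ (s j)) (Finset.mem_univ i),
    Function.update_self]
  have : ∀ j ∈ Finset.univ.erase i, μ (Function.update s i t j) = μ (s j) := fun j hj => by
    rw [Function.update_of_ne (Finset.ne_of_mem_erase hj)]
  rw [Finset.prod_congr rfl this]
  ring

lemma measurePreserving_update (i : ι) :
    MeasurePreserving (fun p : (ι → Z) × Z => Function.update p.1 i p.2)
      ((Measure.pi fun _ => μ).prod μ) (Measure.pi fun _ => μ) :=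
  measurePreserving_fst.comp (measurePreserving_swap_update μ i)

lemma integral_pi_eq_integral_update (i : ι) {F : (ι → Z) → ℝ}
    (hF : Integrable F (Measure.pi fun _ => μ)) :
    ∫ D, F D ∂(Measure.pi fun _ => μ) =
      ∫ D, ∫ z, F (Function.update D i z) ∂μ ∂(Measure.pi fun _ => μ) := by
  have hmp := measurePreserving_update (ι := ι) μ i
  rw [← integral_prod (fun p : (ι → Z) × Z => F (Function.update p.1 i p.2))
    (hmp.integrable_comp_of_integrable hF)]
  conv_lhs => rw [← hmp.map_eq]
  exact integral_map hmp.measurable.aemeasurable (by rw [hmp.map_eq]; exact hF.1)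

/-- Independent samples from a law without atoms have no ties. -/
lemma ae_injective_pi [MeasurableEq Z] [NullSingletonClass μ] :
    ∀ᵐ U ∂(Measure.pi fun _ : ι => μ), Function.Injective U := by
  have hne : ∀ i j : ι, i ≠ j → ∀ᵐ U ∂(Measure.pi fun _ : ι => μ), U i ≠ U j := fun i j hij => by
    have hset : MeasurableSet {U : ι → Z | U i = U j} :=
      measurableSet_eq_fun (measurable_pi_apply i) (measurable_pi_apply j)
    have hpre : MeasurableSet {p : (ι → Z) × Z | p.2 = p.1 j} :=
      measurableSet_eq_fun measurable_snd (by fun_prop)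
    rw [ae_iff]
    simp only [not_not]
    rw [← (measurePreserving_update μ i).measure_preimage hset.nullMeasurableSet]
    have : (fun p : (ι → Z) × Z => Function.update p.1 i p.2) ⁻¹' {U | U i = U j} =
        {p | p.2 = p.1 j} := by
      ext p
      simp [Function.update_of_ne hij.symm]
    rw [this, Measure.prod_apply hpre]
    refine lintegral_eq_zero_of_ae_eq_zero (ae_of_all _ fun U => ?_)
    exact measure_singleton (U j)
  have hall : ∀ᵐ U ∂(Measure.pi fun _ : ι => μ), ∀ i j : ι, i ≠ j → U i ≠ U j := by
    simp only [ae_all_iff]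
    exact hne
  filter_upwards [hall] with U hU i j hij
  by_contra h
  exact hU i j h hij

/-- A weak law of large numbers for the number of sample points in a set, by Chebyshev's
inequality. -/
lemma measureReal_card_lt_le {n k : ℕ} {B : Set Z} (hB : MeasurableSet B)
    [DecidablePred (· ∈ B)] (hp : 0 < μ.real B) (hn : 0 < n) (hk : 2 * (k : ℝ) ≤ n * μ.real B) :
    (Measure.pi fun _ : Fin n => μ).real
      {D | (Finset.univ.filter fun j => D j ∈ B).card < k} ≤ 4 / (n * μ.real B ^ 2) := by
  set p := μ.real B with hpdef
  set P := Measure.pi fun _ : Fin n => μ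
  let f : Z → ℝ := B.indicator 1
  have hf : Measurable f := measurable_one.indicator hB
  have hf01 : ∀ z, f z ∈ Icc (0 : ℝ) 1 := fun z => by
    by_cases hz : z ∈ B <;> simp [f, hz]
  have hfL : MemLp f 2 μ := MemLp.of_bound hf.aestronglyMeasurable 1
    (ae_of_all _ fun z => by rw [Real.norm_of_nonneg (hf01 z).1]; exact (hf01 z).2)
  let X : (Fin n → Z) → ℝ := ∑ j : Fin n, fun D => f (D j)
  have hXapp : ∀ D, X D = ∑ j, f (D j) := fun D => by simp [X]
  have hXj : ∀ j : Fin n, MemLp (fun D : Fin n → Z => f (D j)) 2 P := fun j =>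
    hfL.comp_measurePreserving (measurePreserving_eval (fun _ => μ) j)
  have hXL : MemLp X 2 P := memLp_finsetSum' _ fun j _ => hXj j
  have hXm : P[X] = n * p := by
    have : ∀ j : Fin n, ∫ D : Fin n → Z, f (D j) ∂P = p := fun j => by
      have hmp := measurePreserving_eval (fun _ : Fin n => μ) j
      have := integral_map (μ := P) hmp.measurable.aemeasurable (f := f)
        hf.aestronglyMeasurable
      rw [hmp.map_eq] at this
      rw [hpdef, ← integral_indicator_one hB]
      exact this.symm
    simp only [hXapp]
    rw [integral_finsetSum _ fun j _ => (hXj j).integrable (by norm_num)]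
    simp [this]
  have hXv : Var[X; P] ≤ n := by
    rw [variance_sum_pi fun _ => hfL]
    have : Var[f; μ] ≤ 1 :=
      (variance_le_sq_of_bounded (ae_of_all _ hf01) hf.aemeasurable).trans (by norm_num)
    simpa using Finset.sum_le_sum fun (j : Fin n) (_ : j ∈ Finset.univ) => this
  have hn' : (0 : ℝ) < n := Nat.cast_pos.2 hn
  have hc : 0 < n * p / 2 := by positivity
  have hcheb := meas_ge_le_variance_div_sq hXL hc
  have hsub : {D : Fin n → Z | (Finset.univ.filter fun j => D j ∈ B).card < k} ⊆
      {D | n * p / 2 ≤ |X D - P[X]|} := fun D hD => by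
    have hcard : X D = ((Finset.univ.filter fun j => D j ∈ B).card : ℝ) := by
      rw [hXapp, Finset.card_filter]
      push_cast
      exact Finset.sum_congr rfl fun j _ => by simp [f, indicator_apply]
    have hD' : ((Finset.univ.filter fun j => D j ∈ B).card : ℝ) ≤ k := Nat.cast_le.2 hD.le
    change n * p / 2 ≤ |X D - P[X]|
    rw [hXm, hcard, abs_sub_comm]
    refine le_trans ?_ (le_abs_self _)
    linarith
  refine ENNReal.toReal_le_of_le_ofReal (by positivity)
    (((measure_mono hsub).trans hcheb).trans (ENNReal.ofReal_le_ofReal ?_))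
  calc Var[X; P] / (n * p / 2) ^ 2 ≤ n / (n * p / 2) ^ 2 := by gcongr
    _ = 4 / (n * p ^ 2) := by field_simp; ring

end Resampling

/-! ### The regression function -/

section Regression

variable {E : Type u} [MeasurableSpace E] (μ : Measure (E × Fin 2)) [IsProbabilityMeasure μ]

/-- The regression function `x ↦ P (Y = 1 | X = x)` of the law `μ` of `(X, Y)`. -/
noncomputable def regression (x : E) : ℝ := (μ.condKernel x).real {1}

lemma measurable_regression : Measurable (regression μ) :=
  (Kernel.measurable_coe _ (measurableSet_singleton _)).ennreal_toReal

lemma regression_nonneg (x : E) : 0 ≤ regression μ x := measureReal_nonneg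

lemma regression_le_one (x : E) : regression μ x ≤ 1 := measureReal_le_one

lemma label_mem_Icc (y : Fin 2) : (y : ℝ) ∈ Icc (0 : ℝ) 1 := by
  fin_cases y <;> simp

lemma measurable_label : Measurable fun p : E × Fin 2 => (p.2 : ℝ) :=
  (Measurable.of_discrete (f := fun y : Fin 2 => (y : ℝ))).comp measurable_snd

lemma integrable_of_abs_le {S : Type*} [MeasurableSpace S] {P : Measure S} [IsFiniteMeasure P]
    {f : S → ℝ} (hf : Measurable f) {C : ℝ} (hC : ∀ s, |f s| ≤ C) : Integrable f P :=
  Integrable.of_bound hf.aestronglyMeasurable C (ae_of_all _ hC)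

variable {μ} in
lemma abs_label_sub_regression_le (p : E × Fin 2) : |(p.2 : ℝ) - regression μ p.1| ≤ 1 := by
  have h1 := label_mem_Icc p.2
  have h2 := regression_nonneg μ p.1
  have h3 := regression_le_one μ p.1
  exact abs_le.2 ⟨by linarith [h1.1], by linarith [h1.2]⟩

/-- The defining property of the regression function. -/
lemma integral_mul_label_sub_regression {g : E → ℝ} (hg : Measurable g) {C : ℝ}
    (hC : ∀ x, |g x| ≤ C) :
    ∫ p, g p.1 * ((p.2 : ℝ) - regression μ p.1) ∂μ = 0 := by
  have hint : Integrable (fun p : E × Fin 2 => g p.1 * ((p.2 : ℝ) - regression μ p.1)) μ := by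
    refine integrable_of_abs_le ((hg.comp measurable_fst).mul
      (measurable_label.sub ((measurable_regression μ).comp measurable_fst))) (C := C * 1)
      fun p => ?_
    rw [abs_mul]
    gcongr
    · exact (abs_nonneg _).trans (hC p.1)
    · exact hC _
    · exact abs_label_sub_regression_le p
  rw [← Measure.integral_condKernel hint]
  refine integral_eq_zero_of_ae (ae_of_all _ fun x => ?_)
  have h1 : ∫ y : Fin 2, (y : ℝ) ∂(μ.condKernel x) = regression μ x := by
    have : (fun y : Fin 2 => (y : ℝ)) = indicator {1} 1 := by
      ext y; fin_cases y <;> simp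
    rw [this, integral_indicator_one (measurableSet_singleton _)]
    rfl
  have h2 : Integrable (fun y : Fin 2 => (y : ℝ)) (μ.condKernel x) := Integrable.of_finite
  simp only [Pi.zero_apply]
  rw [integral_const_mul, integral_sub h2 (integrable_const _), h1]
  simp

/-- Averages of the centred labels `Y i - η (X i)` with weights that depend on the points only have
a small second moment, since different centred labels are orthogonal. -/
lemma integral_sq_sum_centered_le {ι : Type*} [Fintype ι] {b : ℝ} {c : ι → (ι → E) → ℝ}
    (hcm : ∀ i, Measurable (c i)) (hc0 : ∀ i X, 0 ≤ c i X) (hcb : ∀ i X, c i X ≤ b)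
    (hb : 0 ≤ b) (hc1 : ∀ X, ∑ i, c i X ≤ 1) :
    ∫ D : ι → E × Fin 2, (∑ i, c i (fun j => (D j).1) *
      (((D i).2 : ℝ) - regression μ (D i).1)) ^ 2 ∂(Measure.pi fun _ => μ) ≤ b := by
  classical
  let ξ : E × Fin 2 → ℝ := fun p => (p.2 : ℝ) - regression μ p.1
  let X : (ι → E × Fin 2) → ι → E := fun D j => (D j).1
  have hξm : Measurable ξ := measurable_label.sub ((measurable_regression μ).comp measurable_fst)
  have hξ1 : ∀ p, |ξ p| ≤ 1 := abs_label_sub_regression_le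
  have hXm : Measurable X := measurable_pi_iff.2 fun j => (measurable_pi_apply j).fst
  let T : ι → (ι → E × Fin 2) → ℝ := fun i D => c i (X D) * ξ (D i)
  have hTm : ∀ i, Measurable (T i) := fun i =>
    ((hcm i).comp hXm).mul (hξm.comp (measurable_pi_apply i))
  have hTb : ∀ i D, |T i D| ≤ b := fun i D => by
    rw [abs_mul, abs_of_nonneg (hc0 i _)]
    simpa using mul_le_mul (hcb i (X D)) (hξ1 (D i)) (abs_nonneg _) hb
  have hTint : ∀ i j, Integrable (fun D => T i D * T j D) (Measure.pi fun _ => μ) := fun i j =>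
    integrable_of_abs_le ((hTm i).mul (hTm j)) (C := b * b) fun D => by
      rw [abs_mul]; exact mul_le_mul (hTb i D) (hTb j D) (abs_nonneg _) hb
  have hoff : ∀ i j, j ≠ i → ∫ D, T i D * T j D ∂(Measure.pi fun _ => μ) = 0 := by
    intro i j hji
    rw [integral_pi_eq_integral_update μ i (hTint i j)]
    refine integral_eq_zero_of_ae (ae_of_all _ fun D => ?_)
    have hX : ∀ z : E × Fin 2, X (Function.update D i z) = Function.update (X D) i z.1 := by
      intro z
      ext l
      rcases eq_or_ne l i with rfl | hl
      · simp [X]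
      · simp [X, Function.update_of_ne hl]
    have hupd : Measurable fun x : E => Function.update (X D) i x := measurable_update _
    have := integral_mul_label_sub_regression μ
      (g := fun x => c i (Function.update (X D) i x) * (c j (Function.update (X D) i x) * ξ (D j)))
      (C := b * (b * 1))
      (((hcm i).comp hupd).mul (((hcm j).comp hupd).mul_const _)) fun x => by
        rw [abs_mul, abs_mul, abs_of_nonneg (hc0 _ _), abs_of_nonneg (hc0 _ _)]
        exact mul_le_mul (hcb _ _) (mul_le_mul (hcb _ _) (hξ1 _) (abs_nonneg _) hb)
          (mul_nonneg (hc0 _ _) (abs_nonneg _)) hb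
    rw [Pi.zero_apply, ← this]
    refine integral_congr_ae (ae_of_all _ fun z => ?_)
    simp only [T, hX, Function.update_self, Function.update_of_ne hji]
    change _ = _ * ξ z
    ring
  have hcint : ∀ i, Integrable (fun D => c i (X D)) (Measure.pi fun _ => μ) := fun i =>
    integrable_of_abs_le ((hcm i).comp hXm) fun D => by
      rw [abs_of_nonneg (hc0 i _)]; exact hcb i _
  calc ∫ D, (∑ i, T i D) ^ 2 ∂(Measure.pi fun _ => μ)
      = ∑ i, ∑ j, ∫ D, T i D * T j D ∂(Measure.pi fun _ => μ) := by
        simp_rw [sq, Finset.sum_mul_sum]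
        rw [integral_finsetSum _ fun i _ => integrable_finsetSum _ fun j _ => hTint i j]
        exact Finset.sum_congr rfl fun i _ => integral_finsetSum _ fun j _ => hTint i j
    _ = ∑ i, ∫ D, T i D * T i D ∂(Measure.pi fun _ => μ) :=
        Finset.sum_congr rfl fun i _ => Finset.sum_eq_single i (fun j _ hj => hoff i j hj) (by simp)
    _ ≤ ∑ i, ∫ D, b * c i (X D) ∂(Measure.pi fun _ => μ) := by
        refine Finset.sum_le_sum fun i _ =>
          integral_mono (hTint i i) ((hcint i).const_mul b) fun D => ?_
        calc T i D * T i D = c i (X D) * c i (X D) * |ξ (D i)| ^ 2 := by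
              rw [sq_abs]; simp only [T]; ring
          _ ≤ b * c i (X D) * 1 := by
              gcongr
              · exact mul_nonneg hb (hc0 _ _)
              · exact hc0 _ _
              · exact hcb _ _
              · exact pow_le_one₀ (abs_nonneg _) (hξ1 _)
          _ = _ := mul_one _
    _ = b * ∫ D, ∑ i, c i (X D) ∂(Measure.pi fun _ => μ) := by
        rw [integral_finsetSum _ fun i _ => hcint i, Finset.mul_sum]
        exact Finset.sum_congr rfl fun i _ => integral_const_mul _ _
    _ ≤ b * ∫ _, 1 ∂(Measure.pi fun _ : ι => μ) := by
        gcongr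
        · exact integrable_finsetSum _ fun i _ => hcint i
        · exact integrable_const _
        · exact fun D => hc1 _
    _ = b := by simp

end Regression

/-! ### Plug-in classifiers -/

section PlugIn

variable {E : Type u} [MeasurableSpace E] (μ : Measure (E × Fin 2)) [IsProbabilityMeasure μ]

lemma measureReal_ne_label {f : E → Fin 2} (hf : Measurable f) :
    μ.real {p | f p.1 ≠ p.2} =
      ∫ p, ((f p.1 : ℝ) + (1 - 2 * (f p.1 : ℝ)) * regression μ p.1) ∂μ := by
  have hfm : Measurable fun x => (f x : ℝ) :=
    (Measurable.of_discrete (f := fun y : Fin 2 => (y : ℝ))).comp hf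
  have hgm : Measurable fun x => 1 - 2 * (f x : ℝ) := measurable_const.sub (hfm.const_mul 2)
  have hg1 : ∀ x, |1 - 2 * (f x : ℝ)| ≤ 1 := fun x => by
    have := label_mem_Icc (f x)
    exact abs_le.2 ⟨by linarith [this.2], by linarith [this.1]⟩
  have hηm : Measurable fun p : E × Fin 2 => regression μ p.1 :=
    (measurable_regression μ).comp measurable_fst
  have hset : MeasurableSet {p : E × Fin 2 | f p.1 ≠ p.2} :=
    (measurableSet_eq_fun (hf.comp measurable_fst) measurable_snd).compl
  have hind : ({p : E × Fin 2 | f p.1 ≠ p.2}.indicator 1 : E × Fin 2 → ℝ) = fun p =>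
      ((f p.1 : ℝ) + (1 - 2 * (f p.1 : ℝ)) * regression μ p.1) +
        (1 - 2 * (f p.1 : ℝ)) * ((p.2 : ℝ) - regression μ p.1) := by
    ext ⟨x, y⟩
    have : ({p : E × Fin 2 | f p.1 ≠ p.2}.indicator 1 (x, y) : ℝ) =
        if f x ≠ y then 1 else 0 := by simp [indicator_apply]
    rw [this]
    dsimp only
    generalize f x = b
    fin_cases b <;> fin_cases y <;> (simp; try ring)
  rw [← integral_indicator_one hset, hind, integral_add,
    integral_mul_label_sub_regression μ hgm hg1, add_zero]
  · refine integrable_of_abs_le ((hfm.comp measurable_fst).add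
      ((hgm.comp measurable_fst).mul hηm)) (C := 1) fun p => ?_
    have h1 := label_mem_Icc (f p.1)
    have h2 := regression_nonneg μ p.1
    have h3 := regression_le_one μ p.1
    exact abs_le.2 ⟨by nlinarith [h1.1, h1.2], by nlinarith [h1.1, h1.2]⟩
  · refine integrable_of_abs_le ((hgm.comp measurable_fst).mul (measurable_label.sub hηm))
      (C := 1 * 1) fun p => ?_
    rw [abs_mul]
    exact mul_le_mul (hg1 _) (abs_label_sub_regression_le p) (abs_nonneg _) zero_le_one

lemma integral_min_le_bayesError :
    ∫ p, min (regression μ p.1) (1 - regression μ p.1) ∂μ ≤ bayesError μ := by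
  have : Nonempty {f : E → Fin 2 // Measurable f} := ⟨⟨fun _ => 0, measurable_const⟩⟩
  have hη : Measurable fun p : E × Fin 2 => regression μ p.1 :=
    (measurable_regression μ).comp measurable_fst
  refine le_ciInf fun f => ?_
  rw [measureReal_ne_label μ f.2]
  have hfm : Measurable fun p : E × Fin 2 => (f.1 p.1 : ℝ) :=
    (Measurable.of_discrete (f := fun y : Fin 2 => (y : ℝ))).comp (f.2.comp measurable_fst)
  refine integral_mono
    (integrable_of_abs_le (hη.min (measurable_const.sub hη)) (C := 1) fun p => ?_)
    (integrable_of_abs_le (hfm.add ((measurable_const.sub (hfm.const_mul 2)).mul hη)) (C := 1)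
      fun p => ?_) fun p => ?_
  · have h2 := regression_nonneg μ p.1
    have h3 := regression_le_one μ p.1
    exact abs_le.2 ⟨le_min (by linarith) (by linarith), (min_le_left _ _).trans h3⟩
  · have h1 := label_mem_Icc (f.1 p.1)
    have h2 := regression_nonneg μ p.1
    have h3 := regression_le_one μ p.1
    exact abs_le.2 ⟨by nlinarith [h1.1, h1.2], by nlinarith [h1.1, h1.2]⟩
  · dsimp only
    generalize f.1 p.1 = b
    fin_cases b
    · simp
    · refine (min_le_right _ _).trans (le_of_eq ?_)
      simp
      ring

/-- The excess error of a plug-in classifier is at most twice the `L¹` error of the estimate of the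
regression function. -/
lemma measureReal_plugIn_ne_le {f : E → ℝ} (hf : Measurable f) {C : ℝ} (hC : ∀ x, |f x| ≤ C) :
    μ.real {p | (if 1 / 2 ≤ f p.1 then (1 : Fin 2) else 0) ≠ p.2} ≤
      bayesError μ + 2 * ∫ p, |f p.1 - regression μ p.1| ∂μ := by
  have hη : Measurable fun p : E × Fin 2 => regression μ p.1 :=
    (measurable_regression μ).comp measurable_fst
  have hg : Measurable fun x => if 1 / 2 ≤ f x then (1 : Fin 2) else 0 :=
    Measurable.ite (measurableSet_le measurable_const hf) measurable_const measurable_const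
  have hgm : Measurable fun p : E × Fin 2 =>
      ((if 1 / 2 ≤ f p.1 then (1 : Fin 2) else 0 : Fin 2) : ℝ) :=
    (Measurable.of_discrete (f := fun y : Fin 2 => (y : ℝ))).comp (hg.comp measurable_fst)
  have hmin : Integrable (fun p : E × Fin 2 =>
      min (regression μ p.1) (1 - regression μ p.1)) μ := by
    refine integrable_of_abs_le (hη.min (measurable_const.sub hη)) (C := 1) fun p => ?_
    have h2 := regression_nonneg μ p.1
    have h3 := regression_le_one μ p.1
    exact abs_le.2 ⟨le_min (by linarith) (by linarith), (min_le_left _ _).trans h3⟩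
  have habs : Integrable (fun p : E × Fin 2 => |f p.1 - regression μ p.1|) μ := by
    refine integrable_of_abs_le ((hf.comp measurable_fst).sub hη).abs (C := C + 1) fun p => ?_
    rw [abs_abs]
    refine (abs_sub _ _).trans (add_le_add (hC _) ?_)
    rw [abs_of_nonneg (regression_nonneg μ _)]
    exact regression_le_one μ _
  have hint : Integrable (fun p : E × Fin 2 =>
      min (regression μ p.1) (1 - regression μ p.1) + 2 * |f p.1 - regression μ p.1|) μ :=
    hmin.add (habs.const_mul 2)
  rw [measureReal_ne_label μ hg]
  calc _ ≤ ∫ p, (min (regression μ p.1) (1 - regression μ p.1) +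
        2 * |f p.1 - regression μ p.1|) ∂μ := by
        refine integral_mono (integrable_of_abs_le
          (hgm.add ((measurable_const.sub (hgm.const_mul 2)).mul hη)) (C := 1)
          fun p => ?_) hint fun p => ?_
        · have h1 := label_mem_Icc (if 1 / 2 ≤ f p.1 then (1 : Fin 2) else 0)
          have h2 := regression_nonneg μ p.1
          have h3 := regression_le_one μ p.1
          exact abs_le.2 ⟨by nlinarith [h1.1, h1.2], by nlinarith [h1.1, h1.2]⟩
        · have h4 := neg_abs_le (f p.1 - regression μ p.1)
          have h5 := le_abs_self (f p.1 - regression μ p.1)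
          have h6 := abs_nonneg (f p.1 - regression μ p.1)
          dsimp only
          rcases min_cases (regression μ p.1) (1 - regression μ p.1) with ⟨h, h'⟩ | ⟨h, h'⟩ <;>
            rw [h] <;> split_ifs with h7 <;> simp <;> linarith
    _ = (∫ p, min (regression μ p.1) (1 - regression μ p.1) ∂μ) +
        2 * ∫ p, |f p.1 - regression μ p.1| ∂μ := by
        rw [integral_add hmin (habs.const_mul 2), integral_const_mul]
    _ ≤ _ := by gcongr; exact integral_min_le_bayesError μ

end PlugIn

/-! ### Convergence of the nearest-neighbour regression estimate -/

section Stone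

variable {E : Type u} [NormedAddCommGroup E] [NormedSpace ℝ E] [FiniteDimensional ℝ E]
  [MeasurableSpace E] [BorelSpace E] (μ : Measure (E × Fin 2)) [IsProbabilityMeasure μ]

open Classical in
lemma measurableSet_card_near_lt (n m : ℕ) (d : ℝ) :
    MeasurableSet {p : (Fin n → E × Fin 2) × (E × Fin 2) |
      (Finset.univ.filter fun j => ‖p.2.1 - (p.1 j).1‖ < d).card < m} := by
  have : Measurable fun p : (Fin n → E × Fin 2) × (E × Fin 2) =>
      (Finset.univ.filter fun j => ‖p.2.1 - (p.1 j).1‖ < d).card := by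
    simp only [Finset.card_filter]
    refine Finset.measurable_sum _ fun j _ =>
      Measurable.ite (measurableSet_lt ?_ measurable_const) measurable_const measurable_const
    exact (measurable_snd.fst.sub ((measurable_pi_apply j).comp measurable_fst).fst).norm
  exact this measurableSet_Iio

open Classical in
/-- Almost every query lies in the support of the law of the points, so a ball around it contains a
positive proportion of the sample, which exceeds `k n / n` for large `n`. -/
lemma tendsto_measureReal_card_near_lt {k : ℕ → ℕ}
    (hkn : Tendsto (fun n : ℕ => (k n : ℝ) / (n : ℝ)) atTop (𝓝 0)) {d : ℝ} (hd : 0 < d) :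
    Tendsto (fun n => ((Measure.pi fun _ : Fin n => μ).prod μ).real
      {p : (Fin n → E × Fin 2) × (E × Fin 2) |
        (Finset.univ.filter fun j => ‖p.2.1 - (p.1 j).1‖ < d).card < k n}) atTop (𝓝 0) := by
  simp only [measureReal_def]
  rw [ENNReal.tendsto_toReal_zero_iff fun n => measure_ne_top _ _]
  simp_rw [Measure.prod_apply_symm (measurableSet_card_near_lt _ _ _)]
  rw [← lintegral_zero (α := E × Fin 2) (μ := μ)]
  refine tendsto_lintegral_of_dominated_convergence (fun _ => 1)
    (fun n => measurable_measure_prodMk_right (measurableSet_card_near_lt _ _ _))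
    (fun n => ae_of_all _ fun q => prob_le_one) (by simp) ?_
  have hsupp : ∀ᵐ q ∂μ, q.1 ∈ μ.fst.support :=
    ae_of_ae_map measurable_fst.aemeasurable Measure.support_mem_ae
  filter_upwards [hsupp] with q hq
  let B : Set (E × Fin 2) := {z | ‖q.1 - z.1‖ < d}
  have hB : MeasurableSet B :=
    measurableSet_lt (measurable_const.sub measurable_fst).norm measurable_const
  have hp : 0 < μ.real B := by
    have h1 := (Measure.mem_support_iff_forall q.1).1 hq _ (Metric.ball_mem_nhds q.1 hd)
    rw [Measure.fst_apply Metric.isOpen_ball.measurableSet] at h1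
    refine ENNReal.toReal_pos (ne_of_gt (h1.trans_le (measure_mono fun z hz => ?_)))
      (measure_ne_top _ _)
    change ‖q.1 - z.1‖ < d
    rw [← dist_eq_norm, dist_comm]
    exact hz
  rw [← ENNReal.tendsto_toReal_zero_iff fun n => measure_ne_top _ _]
  have hlim : Tendsto (fun n : ℕ => 4 / ((n : ℝ) * μ.real B ^ 2)) atTop (𝓝 0) :=
    Tendsto.div_atTop tendsto_const_nhds
      (tendsto_natCast_atTop_atTop.atTop_mul_const (by positivity))
  refine squeeze_zero' (Eventually.of_forall fun n => ENNReal.toReal_nonneg) ?_ hlim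
  filter_upwards [hkn.eventually_lt_const (half_pos hp), eventually_gt_atTop 0] with n hn hn0
  have hn0' : (0 : ℝ) < n := Nat.cast_pos.2 hn0
  rw [div_lt_iff₀ hn0'] at hn
  exact measureReal_card_lt_le μ hB hp hn0 (by linarith)

/-- **Stone's lemma**: the nearest neighbours at distance less than `a ≤ r` of the query average a
bounded nonnegative function `h` to at most a constant times its mean. Exchanging the query with
the `i`-th point turns the sum over the neighbours of the query into a sum over the points which
have the query among their neighbours. -/
lemma integral_sum_near_le {r ε : ℝ} {δ : ℝ → ℝ} {ρ : E → ℝ} (hρm : Measurable ρ)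
    (hρ : IsConeMonotone r ε δ ρ) {C : Finset E}
    (hC : ∀ u : E, u ≠ 0 → ∃ c ∈ C, ‖‖u‖⁻¹ • u - c‖ < ε / 2) {k n : ℕ} (hk : 0 < k)
    {U : Fin n → ℝ} (hU : Function.Injective U) {a : ℝ} (ha : a ≤ r) {h : E → ℝ}
    (hm : Measurable h) (h0 : ∀ x, 0 ≤ h x) {M : ℝ} (hM : ∀ x, h x ≤ M) :
    ∫ p : (Fin n → E × Fin 2) × (E × Fin 2), (∑ i, knnWeight ρ k (fun j => (p.1 j).1) U p.2.1 i *
      (if ‖p.2.1 - (p.1 i).1‖ < a then h (p.1 i).1 else 0)) ∂((Measure.pi fun _ => μ).prod μ) ≤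
      (C.card + 1) * ∫ q, h q.1 ∂μ := by
  classical
  set P := (Measure.pi fun _ : Fin n => μ).prod μ
  let G : Fin n → (Fin n → E × Fin 2) × (E × Fin 2) → ℝ := fun i p =>
    knnWeight ρ k (fun j => (p.1 j).1) U p.2.1 i *
      (if ‖p.2.1 - (p.1 i).1‖ < a then h (p.1 i).1 else 0)
  let T : Fin n → (Fin n → E × Fin 2) × (E × Fin 2) → (Fin n → E × Fin 2) × (E × Fin 2) :=
    fun i p => (Function.update p.1 i p.2, p.1 i)
  have hT : ∀ i, MeasurePreserving (T i) P P := fun i => measurePreserving_swap_update μ i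
  have hM0 : 0 ≤ M := (h0 0).trans (hM 0)
  have hpt : ∀ i : Fin n, Measurable fun p : (Fin n → E × Fin 2) × (E × Fin 2) => (p.1 i).1 :=
    fun i => ((measurable_pi_apply i).comp measurable_fst).fst
  have hGm : ∀ i, Measurable (G i) := fun i =>
    (measurable_knnWeight (ρ := fun _ => ρ) (hρm.comp measurable_snd)
      (measurable_pi_iff.2 hpt) measurable_const measurable_snd.fst k i).mul
      (Measurable.ite (measurableSet_lt (measurable_snd.fst.sub (hpt i)).norm measurable_const)
        (hm.comp (hpt i)) measurable_const)
  have hGi : ∀ i, Integrable (G i) P := fun i =>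
    integrable_of_abs_le (hGm i) (C := 1 / k * M) fun p => by
      rw [abs_mul, abs_of_nonneg (knnWeight_nonneg _ _ _ _ _ _)]
      refine mul_le_mul (knnWeight_le _ _ _ _ _ _) ?_ (abs_nonneg _) (by positivity)
      split_ifs
      · rw [abs_of_nonneg (h0 _)]; exact hM _
      · simpa using hM0
  have hhi : Integrable (fun p : (Fin n → E × Fin 2) × (E × Fin 2) => h p.2.1) P :=
    integrable_of_abs_le (hm.comp measurable_snd.fst) (C := M) fun p => by
      rw [abs_of_nonneg (h0 _)]; exact hM _
  have hpoint : ∀ p, ∑ i, G i (T i p) ≤ (C.card + 1) * h p.2.1 := by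
    rintro ⟨D, q⟩
    have hX : ∀ i, (fun j => (Function.update D i q j).1) =
        Function.update (fun j => (D j).1) i q.1 := fun i => by
      ext j
      rcases eq_or_ne j i with rfl | hj
      · simp
      · simp [Function.update_of_ne hj]
    set S := Finset.univ.filter fun i : Fin n => ‖(D i).1 - q.1‖ < r ∧
      IsKNearest ρ k (Function.update (fun j => (D j).1) i q.1) U (D i).1 i
    have hcard : (S.card : ℝ) ≤ (C.card + 1) * k := by
      exact_mod_cast card_isKNearest_update_le hρ hC k (fun j => (D j).1) hU q.1
    have hterm : ∀ i, G i (T i (D, q)) ≤ if i ∈ S then 1 / (k : ℝ) * h q.1 else 0 := fun i => by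
      simp only [G, T, hX, Function.update_self, knnWeight, S, Finset.mem_filter,
        Finset.mem_univ, true_and]
      have hpos : 0 ≤ 1 / (k : ℝ) * h q.1 := mul_nonneg (by positivity) (h0 _)
      by_cases h1 : IsKNearest ρ k (Function.update (fun j => (D j).1) i q.1) U (D i).1 i
      · by_cases h2 : ‖(D i).1 - q.1‖ < a
        · rw [if_pos h1, if_pos h2, if_pos ⟨h2.trans_le ha, h1⟩]
        · rw [if_neg h2, mul_zero]; split_ifs <;> [exact hpos; exact le_rfl]
      · rw [if_neg h1, zero_mul]; split_ifs <;> [exact hpos; exact le_rfl]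
    have hk' : (0 : ℝ) < k := Nat.cast_pos.2 hk
    calc ∑ i, G i (T i (D, q)) ≤ ∑ i, if i ∈ S then 1 / (k : ℝ) * h q.1 else 0 :=
          Finset.sum_le_sum fun i _ => hterm i
      _ = S.card * (1 / (k : ℝ) * h q.1) := by
          rw [Finset.sum_ite_mem, Finset.univ_inter, Finset.sum_const, nsmul_eq_mul]
      _ ≤ ((C.card + 1) * k) * (1 / (k : ℝ) * h q.1) := by
          gcongr
          exact mul_nonneg (by positivity) (h0 _)
      _ = (C.card + 1) * h q.1 := by field_simp
  calc ∫ p, ∑ i, G i p ∂P = ∑ i, ∫ p, G i (T i p) ∂P := by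
        rw [integral_finsetSum _ fun i _ => hGi i]
        refine Finset.sum_congr rfl fun i _ => ?_
        conv_lhs => rw [← (hT i).map_eq]
        exact integral_map (hT i).measurable.aemeasurable (hGm i).aestronglyMeasurable
    _ = ∫ p, ∑ i, G i (T i p) ∂P :=
        (integral_finsetSum _ fun i _ => (hT i).integrable_comp_of_integrable (hGi i)).symm
    _ ≤ ∫ p, (C.card + 1) * h p.2.1 ∂P :=
        integral_mono (integrable_finsetSum _ fun i _ =>
          (hT i).integrable_comp_of_integrable (hGi i)) (hhi.const_mul _) hpoint
    _ = (C.card + 1) * ∫ q, h q.1 ∂μ := by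
        rw [integral_const_mul]
        congr 1
        have hs : MeasurePreserving Prod.snd P μ := measurePreserving_snd
        conv_rhs => rw [← hs.map_eq]
        exact (integral_map hs.measurable.aemeasurable
          (hm.comp measurable_fst).aestronglyMeasurable).symm
end Stone

/-- The error of a weighted average of labels with weights `w i`, at a query with regression value
`e`: a centred average, an approximation error `h i` at the near points, and the error `F` due to
the far points. -/
lemma abs_sum_label_sub_le {ι : Type*} [Fintype ι] {w y η h : ι → ℝ} {near : ι → Prop}
    [DecidablePred near] {e κ h0 F : ℝ} (hκ : 0 < κ) (hw : ∀ i, 0 ≤ w i) (hw1 : ∑ i, w i = 1)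
    (hnear : ∀ i, near i → |η i - e| ≤ h i + κ + h0)
    (hfar : ∀ i, ¬ near i → w i * |η i - e| ≤ w i * F) (hh0 : 0 ≤ h0) (hF : 0 ≤ F) :
    |(∑ i, y i * w i) - e| ≤ κ + (∑ i, w i * (y i - η i)) ^ 2 / κ +
      (∑ i, w i * if near i then h i else 0) + (κ + h0 + F) := by
  have hsplit : (∑ i, y i * w i) - e = (∑ i, w i * (y i - η i)) + ∑ i, w i * (η i - e) := by
    have : e = ∑ i, w i * e := by rw [← Finset.sum_mul, hw1, one_mul]
    conv_lhs => rw [this]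
    rw [← Finset.sum_sub_distrib, ← Finset.sum_add_distrib]
    exact Finset.sum_congr rfl fun i _ => by ring
  have h1 : |∑ i, w i * (y i - η i)| ≤ κ + (∑ i, w i * (y i - η i)) ^ 2 / κ := by
    set s := ∑ i, w i * (y i - η i)
    rw [← sub_le_iff_le_add', le_div_iff₀ hκ, ← sq_abs]
    nlinarith [sq_nonneg (|s| - κ), abs_nonneg s, sq_nonneg |s|]
  have h2 : ∀ i, |w i * (η i - e)| ≤ (w i * if near i then h i else 0) + w i * (κ + h0 + F) := by
    intro i
    rw [abs_mul, abs_of_nonneg (hw i)]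
    by_cases hi : near i
    · rw [if_pos hi, ← mul_add]
      exact mul_le_mul_of_nonneg_left (by linarith [hnear i hi]) (hw i)
    · rw [if_neg hi, mul_zero, zero_add]
      exact (hfar i hi).trans (mul_le_mul_of_nonneg_left (by linarith) (hw i))
  have h3 : |∑ i, w i * (η i - e)| ≤ (∑ i, w i * if near i then h i else 0) + (κ + h0 + F) := by
    refine (Finset.abs_sum_le_sum_abs _ _).trans ((Finset.sum_le_sum fun i _ => h2 i).trans ?_)
    rw [Finset.sum_add_distrib, ← Finset.sum_mul, hw1, one_mul]
  rw [hsplit]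
  exact (abs_add_le _ _).trans (by linarith)

lemma knnEstimate_mem_Icc {E : Type u} [Sub E] (ρ : E → ℝ) {k n : ℕ} (hk : 0 < k) (hkn : k ≤ n)
    (D : Fin n → E × Fin 2) {U : Fin n → ℝ} (hU : Function.Injective U) (x : E) :
    knnEstimate ρ k D U x ∈ Icc (0 : ℝ) 1 := by
  refine ⟨Finset.sum_nonneg fun i _ =>
    mul_nonneg (label_mem_Icc _).1 (knnWeight_nonneg _ _ _ _ _ _), ?_⟩
  rw [← sum_knnWeight ρ hk hkn (fun j => (D j).1) hU x]
  exact Finset.sum_le_sum fun i _ =>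
    mul_le_of_le_one_left (knnWeight_nonneg _ _ _ _ _ _) (label_mem_Icc _).2

section Convergence

variable {E : Type u} [NormedAddCommGroup E] [NormedSpace ℝ E] [FiniteDimensional ℝ E]
  [MeasurableSpace E] [BorelSpace E] (μ : Measure (E × Fin 2)) [IsProbabilityMeasure μ]

/-- The regression function is approximated in `L¹` by a continuous function with compact support,
with error function `h`. The variance term is controlled by orthogonality, the error `h` at the
near neighbours by Stone's lemma, and the far neighbours by the law of large numbers. All bounds are
uniform in the distance and in the tie-breakers. -/
theorem eventually_integral_abs_knnEstimate_sub_le {r ε : ℝ} {δ : ℝ → ℝ} (hr : 0 < r)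
    (hε : 0 < ε) (hδ : ∀ a > 0, 0 < δ a) {k : ℕ → ℕ} (hk : Tendsto k atTop atTop)
    (hkn : Tendsto (fun n : ℕ => (k n : ℝ) / (n : ℝ)) atTop (𝓝 0)) {κ : ℝ} (hκ : 0 < κ) :
    ∀ᶠ n in atTop, ∀ ρ : E → ℝ, Measurable ρ → IsConeMonotone r ε δ ρ →
      ∀ U : Fin n → ℝ, Function.Injective U →
        ∫ p : (Fin n → E × Fin 2) × (E × Fin 2),
          |knnEstimate ρ (k n) p.1 U p.2.1 - regression μ p.2.1|
            ∂((Measure.pi fun _ => μ).prod μ) ≤ κ := by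
  classical
  obtain ⟨C, hC⟩ := exists_finset_directions E hε
  -- Stone's lemma contributes `(C.card + 1) * e`, and there are five further terms of size `e`.
  set e : ℝ := κ / (C.card + 6) with he
  have he0 : 0 < e := by positivity
  have hηint : Integrable (regression μ) μ.fst :=
    integrable_of_abs_le (measurable_regression μ) (C := 1) fun x => by
      rw [abs_of_nonneg (regression_nonneg μ x)]; exact regression_le_one μ x
  obtain ⟨g, hgs, hge, hgc, -⟩ := hηint.exists_hasCompactSupport_integral_sub_le he0
  obtain ⟨M, hM⟩ := hgs.exists_bound_of_continuous hgc
  let h : E → ℝ := fun x => |regression μ x - g x|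
  have hm : Measurable h := ((measurable_regression μ).sub hgc.measurable).abs
  have hh0 : ∀ x, 0 ≤ h x := fun x => abs_nonneg _
  have hhM : ∀ x, h x ≤ 1 + M := fun x => by
    refine (abs_sub _ _).trans (add_le_add ?_ (hM x))
    rw [abs_of_nonneg (regression_nonneg μ x)]
    exact regression_le_one μ x
  have hhe : ∫ q, h q.1 ∂μ ≤ e := by
    rw [← integral_map (f := h) measurable_fst.aemeasurable hm.aestronglyMeasurable]
    exact hge
  obtain ⟨a', ha'0, ha'⟩ := Metric.uniformContinuous_iff.1
    (hgs.uniformContinuous_of_continuous hgc) e he0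
  set a := min a' r
  have ha0 : 0 < a := lt_min ha'0 hr
  have hk0 : ∀ᶠ n in atTop, 0 < k n := hk.eventually_gt_atTop 0
  have hkn' : ∀ᶠ n : ℕ in atTop, k n ≤ n := by
    filter_upwards [hkn.eventually_lt_const one_pos, eventually_gt_atTop 0] with n hn hn0
    rw [div_lt_one (Nat.cast_pos.2 hn0)] at hn
    exact_mod_cast hn.le
  have hke : ∀ᶠ n in atTop, 1 / (k n : ℝ) / e ≤ e := by
    have : Tendsto (fun n => 1 / (k n : ℝ) / e) atTop (𝓝 (0 / e)) :=
      (tendsto_one_div_atTop_nhds_zero_nat.comp hk).div_const e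
    rw [zero_div] at this
    exact this.eventually_le_const he0
  filter_upwards [hk0, hkn', hke,
    (tendsto_measureReal_card_near_lt μ hkn (hδ a ha0)).eventually_le_const he0]
    with n hkpos hkn hke hfar ρ hρm hρ U hU
  set P := (Measure.pi fun _ : Fin n => μ).prod μ
  set S := {p : (Fin n → E × Fin 2) × (E × Fin 2) |
        (Finset.univ.filter fun j => ‖p.2.1 - (p.1 j).1‖ < δ a).card < k n}
  have hS : MeasurableSet S := measurableSet_card_near_lt n (k n) (δ a)
  let W : (Fin n → E × Fin 2) × (E × Fin 2) → Fin n → ℝ := fun p i =>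
    knnWeight ρ (k n) (fun j => (p.1 j).1) U p.2.1 i
  have hpt : ∀ i : Fin n, Measurable fun p : (Fin n → E × Fin 2) × (E × Fin 2) => (p.1 i).1 :=
    fun i => ((measurable_pi_apply i).comp measurable_fst).fst
  have hlab : ∀ i : Fin n, Measurable fun p : (Fin n → E × Fin 2) × (E × Fin 2) =>
      ((p.1 i).2 : ℝ) := fun i =>
    measurable_label.comp ((measurable_pi_apply i).comp measurable_fst)
  have hWm : ∀ i, Measurable fun p => W p i := fun i =>
    measurable_knnWeight (ρ := fun _ => ρ) (hρm.comp measurable_snd)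
      (measurable_pi_iff.2 hpt) measurable_const measurable_snd.fst (k n) i
  have hW0 : ∀ p i, 0 ≤ W p i := fun p i => knnWeight_nonneg _ _ _ _ _ _
  have hW1 : ∀ p, ∑ i, W p i = 1 := fun p => sum_knnWeight ρ hkpos hkn _ hU _
  have havg : ∀ p (f : Fin n → ℝ) (B : ℝ), (∀ i, |f i| ≤ B) → |∑ i, W p i * f i| ≤ B := by
    intro p f B hf
    refine (Finset.abs_sum_le_sum_abs _ _).trans ?_
    calc ∑ i, |W p i * f i| ≤ ∑ i, W p i * B := Finset.sum_le_sum fun i _ => by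
          rw [abs_mul, abs_of_nonneg (hW0 p i)]
          exact mul_le_mul_of_nonneg_left (hf i) (hW0 p i)
      _ = B := by rw [← Finset.sum_mul, hW1, one_mul]
  let V : (Fin n → E × Fin 2) × (E × Fin 2) → ℝ := fun p =>
    ∑ i, W p i * (((p.1 i).2 : ℝ) - regression μ (p.1 i).1)
  have hVm : Measurable V := Finset.measurable_sum _ fun i _ =>
    (hWm i).mul ((hlab i).sub ((measurable_regression μ).comp (hpt i)))
  have hV1 : ∀ p, |V p| ≤ 1 := fun p => havg p _ 1 fun i => abs_label_sub_regression_le _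
  let N : (Fin n → E × Fin 2) × (E × Fin 2) → ℝ := fun p =>
    ∑ i, W p i * if ‖p.2.1 - (p.1 i).1‖ < a then h (p.1 i).1 else 0
  have hNm : Measurable N := Finset.measurable_sum _ fun i _ => (hWm i).mul
    (Measurable.ite (measurableSet_lt (measurable_snd.fst.sub (hpt i)).norm measurable_const)
      (hm.comp (hpt i)) measurable_const)
  have hNb : ∀ p, |N p| ≤ 1 + M := fun p => havg p _ _ fun i => by
    split_ifs
    · rw [abs_of_nonneg (hh0 _)]; exact hhM _
    · rw [abs_zero]; exact (hh0 0).trans (hhM 0)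
  have hVi : Integrable (fun p => V p ^ 2) P := integrable_of_abs_le (hVm.pow_const 2) (C := 1)
    fun p => by rw [abs_pow]; exact pow_le_one₀ (abs_nonneg _) (hV1 p)
  have hNi : Integrable N P := integrable_of_abs_le hNm hNb
  have hhi : Integrable (fun p : (Fin n → E × Fin 2) × (E × Fin 2) => h p.2.1) P :=
    integrable_of_abs_le (hm.comp measurable_snd.fst) (C := 1 + M) fun p => by
      rw [abs_of_nonneg (hh0 _)]; exact hhM _
  have hSi : Integrable (S.indicator (1 : (Fin n → E × Fin 2) × (E × Fin 2) → ℝ)) P :=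
    (integrable_const 1).indicator hS
  have hest : Measurable fun p : (Fin n → E × Fin 2) × (E × Fin 2) =>
      knnEstimate ρ (k n) p.1 U p.2.1 :=
    measurable_knnEstimate (ρ := fun _ => ρ) (hρm.comp measurable_snd) measurable_fst
      measurable_const measurable_snd.fst (k n)
  have hEi : Integrable (fun p : (Fin n → E × Fin 2) × (E × Fin 2) =>
      |knnEstimate ρ (k n) p.1 U p.2.1 - regression μ p.2.1|) P := by
    refine integrable_of_abs_le
      (hest.sub ((measurable_regression μ).comp measurable_snd.fst)).abs (C := 1) fun p => ?_
    have h1 := knnEstimate_mem_Icc ρ hkpos hkn p.1 hU p.2.1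
    have h2 := regression_nonneg μ p.2.1
    have h3 := regression_le_one μ p.2.1
    rw [abs_abs]
    exact abs_le.2 ⟨by linarith [h1.1], by linarith [h1.2]⟩
  have hpoint : ∀ p, |knnEstimate ρ (k n) p.1 U p.2.1 - regression μ p.2.1| ≤
      e + V p ^ 2 / e + N p + (e + h p.2.1 + S.indicator 1 p) := by
    intro p
    refine abs_sum_label_sub_le he0 (hW0 p) (hW1 p) (fun i hi => ?_) (fun i hi => ?_) (hh0 _)
      (indicator_nonneg (fun _ _ => zero_le_one) _)
    · have h1 : |g (p.1 i).1 - g p.2.1| ≤ e := by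
        rw [← Real.dist_eq, dist_comm]
        refine (ha' ?_).le
        rw [dist_eq_norm]
        exact hi.trans_le (min_le_left _ _)
      calc |regression μ (p.1 i).1 - regression μ p.2.1|
          ≤ |regression μ (p.1 i).1 - g (p.1 i).1| + |g (p.1 i).1 - regression μ p.2.1| :=
            abs_sub_le _ _ _
        _ ≤ |regression μ (p.1 i).1 - g (p.1 i).1| +
            (|g (p.1 i).1 - g p.2.1| + |g p.2.1 - regression μ p.2.1|) := by
            gcongr; exact abs_sub_le _ _ _
        _ ≤ h (p.1 i).1 + e + h p.2.1 := by
            rw [abs_sub_comm (g p.2.1)]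
            simp only [h]
            linarith
    -- A far point has weight zero unless the event `S` occurs.
    · by_cases hn : IsKNearest ρ (k n) (fun j => (p.1 j).1) U p.2.1 i
      · have hpS : p ∈ S := hn.card_lt hρ ha0 (not_lt.1 hi)
        rw [indicator_of_mem hpS, Pi.one_apply]
        refine mul_le_mul_of_nonneg_left (abs_le.2 ⟨?_, ?_⟩) (hW0 p i) <;>
          linarith [regression_nonneg μ (p.1 i).1, regression_le_one μ (p.1 i).1,
            regression_nonneg μ p.2.1, regression_le_one μ p.2.1]
      · have : W p i = 0 := if_neg hn
        change W p i * _ ≤ W p i * _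
        rw [this, zero_mul, zero_mul]
  have hVle : ∫ p, V p ^ 2 ∂P ≤ 1 / k n := by
    rw [integral_prod_symm _ hVi]
    have hin : ∀ q : E × Fin 2, ∫ D, V (D, q) ^ 2 ∂(Measure.pi fun _ => μ) ≤ 1 / k n := fun q =>
      integral_sq_sum_centered_le μ (c := fun i X => knnWeight ρ (k n) X U q.1 i)
        (fun i => measurable_knnWeight (ρ := fun _ => ρ) (hρm.comp measurable_snd)
          measurable_id measurable_const measurable_const (k n) i)
        (fun i X => knnWeight_nonneg _ _ _ _ _ _) (fun i X => knnWeight_le _ _ _ _ _ _)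
        (by positivity) (fun X => (sum_knnWeight ρ hkpos hkn _ hU _).le)
    calc _ ≤ ∫ _, 1 / (k n : ℝ) ∂μ :=
          integral_mono hVi.integral_prod_right (integrable_const _) hin
      _ = 1 / k n := by simp
  have hNle : ∫ p, N p ∂P ≤ (C.card + 1) * e :=
    (integral_sum_near_le μ hρm hρ hC hkpos hU (min_le_right _ _) hm hh0 hhM).trans (by gcongr)
  have hhle : ∫ p, h p.2.1 ∂P ≤ e := by
    have hs : MeasurePreserving Prod.snd P μ := measurePreserving_snd
    refine le_trans (le_of_eq ?_) hhe
    conv_rhs => rw [← hs.map_eq]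
    exact (integral_map hs.measurable.aemeasurable
      (hm.comp measurable_fst).aestronglyMeasurable).symm
  have hSle : ∫ p, S.indicator (1 : (Fin n → E × Fin 2) × (E × Fin 2) → ℝ) p ∂P ≤ e := by
    rw [integral_indicator_one hS]; exact hfar
  have hc : Integrable (fun _ : (Fin n → E × Fin 2) × (E × Fin 2) => e) P := integrable_const e
  have hVd := hVi.div_const e
  have h12 : Integrable (fun p => e + V p ^ 2 / e) P := hc.add hVd
  have h123 : Integrable (fun p => e + V p ^ 2 / e + N p) P := h12.add hNi
  have h45 : Integrable (fun p => e + h p.2.1) P := hc.add hhi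
  have h456 : Integrable (fun p => e + h p.2.1 + S.indicator 1 p) P := h45.add hSi
  calc _ ≤ ∫ p, (e + V p ^ 2 / e + N p + (e + h p.2.1 + S.indicator 1 p)) ∂P :=
        integral_mono hEi (h123.add h456) hpoint
    _ = e + (∫ p, V p ^ 2 ∂P) / e + (∫ p, N p ∂P) +
        (e + (∫ p, h p.2.1 ∂P) +
          ∫ p, S.indicator (1 : (Fin n → E × Fin 2) × (E × Fin 2) → ℝ) p ∂P) := by
        rw [integral_add h123 h456, integral_add h12 hNi, integral_add hc hVd,
          integral_add h45 hSi, integral_add hc hhi, integral_div e (fun p => V p ^ 2)]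
        simp
    _ ≤ e + e + (C.card + 1) * e + (e + e + e) := by
        have : (∫ p, V p ^ 2 ∂P) / e ≤ e :=
          (div_le_div_of_nonneg_right hVle he0.le).trans hke
        linarith
    _ = κ := by rw [he]; field_simp; ring

end Convergence

/-! ### Consistency from convergence of the expected error -/

section Consistency

variable {E : Type u} [MeasurableSpace E]

lemma bayesError_nonneg (μ : Measure (E × Fin 2)) : 0 ≤ bayesError μ :=
  Real.iInf_nonneg fun _ => measureReal_nonneg

lemma ofReal_bayesError_le (μ : Measure (E × Fin 2)) [IsProbabilityMeasure μ] {f : E → Fin 2}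
    (hf : Measurable f) : ENNReal.ofReal (bayesError μ) ≤ μ {p | f p.1 ≠ p.2} := by
  rw [ENNReal.ofReal_le_iff_le_toReal (measure_ne_top _ _)]
  exact ciInf_le (f := fun f : {f : E → Fin 2 // Measurable f} => μ.real {p | f.1 p.1 ≠ p.2})
    ⟨0, by rintro _ ⟨f, rfl⟩; exact measureReal_nonneg⟩ ⟨f, hf⟩

/-- The conditional error given the sample is almost surely at least the Bayes error, because the
classifier is a Borel function of the query once the sample and the auxiliary variable are fixed.
Convergence in probability therefore follows from convergence of the expected error. -/
theorem isConsistent_of_forall_eventually_le {A : ℕ → Type v} [∀ n, MeasurableSpace (A n)]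
    {ν : ∀ n, Measure (A n)} [∀ n, IsProbabilityMeasure (ν n)] {L : LearningRule E A}
    (hL : ∀ n, Measurable fun p : (Fin n → E × Fin 2) × A n × E => L n p.1 p.2.1 p.2.2)
    {μ : Measure (E × Fin 2)} [IsProbabilityMeasure μ]
    (h : ∀ κ > 0, ∀ᶠ n in atTop, (ν n).prod ((Measure.pi fun _ : Fin n => μ).prod μ)
      {a | L n a.2.1 a.1 a.2.2.1 ≠ a.2.2.2} ≤ ENNReal.ofReal (bayesError μ + κ)) :
    IsConsistent.{u, v, w} ν L μ := by
  intro Ω _ P _ Z Q W hZ hZμ hZi hQ hQμ hDQ hW hWν hWDQ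
  set b := bayesError μ
  have hb : 0 ≤ b := bayesError_nonneg μ
  let D : ∀ n, Ω → Fin n → E × Fin 2 := fun n ω i => Z i ω
  let S : ∀ n, Set (A n × (Fin n → E × Fin 2) × E × Fin 2) := fun n =>
    {a | L n a.2.1 a.1 a.2.2.1 ≠ a.2.2.2}
  let J : ∀ n, Ω → A n × (Fin n → E × Fin 2) × E × Fin 2 := fun n ω => (W n ω, D n ω, Q ω)
  have hD : ∀ n, Measurable (D n) := fun n => measurable_pi_iff.2 fun i => hZ i
  have hS : ∀ n, MeasurableSet (S n) := fun n =>
    (measurableSet_eq_fun ((hL n).comp (measurable_snd.fst.prodMk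
      (measurable_fst.prodMk measurable_snd.snd.fst))) measurable_snd.snd.snd).compl
  have hJ : ∀ n, Measurable (J n) := fun n => (hW n).prodMk ((hD n).prodMk hQ)
  have hJlaw : ∀ n, P.map (J n) = (ν n).prod ((Measure.pi fun _ : Fin n => μ).prod μ) := by
    intro n
    have h1 : P.map (D n) = Measure.pi fun _ : Fin n => μ := by
      have := (iIndepFun_iff_map_fun_eq_pi_map fun i : Fin n => (hZ i).aemeasurable).1
        (hZi.precomp (g := fun i : Fin n => (i : ℕ)) Fin.val_injective)
      simpa only [hZμ] using this
    have h2 := (indepFun_iff_map_prod_eq_prod_map_map (hD n).aemeasurable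
      hQ.aemeasurable).1 (hDQ n)
    have h3 := (indepFun_iff_map_prod_eq_prod_map_map (hW n).aemeasurable
      ((hD n).prodMk hQ).aemeasurable).1 (hWDQ n)
    rw [h1, hQμ] at h2
    rw [h2, hWν] at h3
    exact h3
  let Err : ∀ n, Set Ω := fun n => J n ⁻¹' S n
  have hErr : ∀ n, MeasurableSet (Err n) := fun n => hJ n (hS n)
  have hErrP : ∀ n, P (Err n) = (ν n).prod ((Measure.pi fun _ : Fin n => μ).prod μ) (S n) :=
    fun n => by rw [← hJlaw, Measure.map_apply (hJ n) (hS n)]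
  have hlow : ∀ n (B : Set (Fin n → E × Fin 2)), MeasurableSet B →
      b * P.real (D n ⁻¹' B) ≤ P.real (Err n ∩ D n ⁻¹' B) := by
    intro n B hB
    have hSB : MeasurableSet (S n ∩ {a | a.2.1 ∈ B}) := (hS n).inter (measurable_snd.fst hB)
    have h1 : P (Err n ∩ D n ⁻¹' B) =
        (ν n).prod ((Measure.pi fun _ : Fin n => μ).prod μ) (S n ∩ {a | a.2.1 ∈ B}) := by
      rw [← hJlaw, Measure.map_apply (hJ n) hSB]; rfl
    have h2 : P (D n ⁻¹' B) = (Measure.pi fun _ : Fin n => μ) B := by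
      have : P (D n ⁻¹' B) = P.map (J n) {a | a.2.1 ∈ B} :=
        (Measure.map_apply (hJ n) (measurable_snd.fst hB)).symm
      rw [this, hJlaw]
      have hset : {a : A n × (Fin n → E × Fin 2) × E × Fin 2 | a.2.1 ∈ B} =
          univ ×ˢ (B ×ˢ univ) := by ext; simp
      rw [hset, Measure.prod_prod, Measure.prod_prod, measure_univ, measure_univ, one_mul, mul_one]
    have h3 : ENNReal.ofReal b * P (D n ⁻¹' B) ≤ P (Err n ∩ D n ⁻¹' B) := by
      rw [h1, h2, Measure.prod_apply hSB]
      calc ENNReal.ofReal b * (Measure.pi fun _ : Fin n => μ) B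
          = ∫⁻ _, ENNReal.ofReal b * (Measure.pi fun _ : Fin n => μ) B ∂(ν n) := by simp
        _ ≤ _ := lintegral_mono fun w => ?_
      rw [Measure.prod_apply (measurable_prodMk_left hSB)]
      calc ENNReal.ofReal b * (Measure.pi fun _ : Fin n => μ) B
          = ∫⁻ D', B.indicator (fun _ => ENNReal.ofReal b) D' ∂(Measure.pi fun _ => μ) := by
            rw [lintegral_indicator_const hB]
        _ ≤ _ := lintegral_mono fun D' => ?_
      by_cases hD' : D' ∈ B
      · rw [indicator_of_mem hD']
        refine (ofReal_bayesError_le μ (f := fun x => L n D' w x)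
          ((hL n).comp (measurable_const.prodMk (measurable_const.prodMk measurable_id)))).trans
          (measure_mono fun q hq => ⟨hq, hD'⟩)
      · rw [indicator_of_notMem hD']; exact zero_le
    have h4 := ENNReal.toReal_mono (measure_ne_top _ _) h3
    rwa [ENNReal.toReal_mul, ENNReal.toReal_ofReal hb] at h4
  have hm : ∀ n, MeasurableSpace.comap (D n) inferInstance ≤ (inferInstance : MeasurableSpace Ω) :=
    fun n => (hD n).comap_le
  let e : ∀ n, Ω → ℝ := fun n => P⟦Err n | MeasurableSpace.comap (D n) inferInstance⟧
  have hind : ∀ n, Integrable ((Err n).indicator fun _ => (1 : ℝ)) P := fun n =>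
    (integrable_const 1).indicator (hErr n)
  have hei : ∀ n, Integrable (e n) P := fun n => integrable_condExp
  have hge : ∀ n, ∀ᵐ ω ∂P, b ≤ e n ω := by
    intro n
    refine ae_of_ae_trim (hm n) ?_
    refine ae_le_of_forall_setIntegral_le (integrable_const b)
      ((hei n).trim (hm n) stronglyMeasurable_condExp) ?_
    rintro s hs -
    rw [← setIntegral_trim (hm n) stronglyMeasurable_const hs,
      ← setIntegral_trim (hm n) stronglyMeasurable_condExp hs,
      setIntegral_condExp (hm n) (hind n) hs]
    obtain ⟨B, hB, rfl⟩ := hs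
    rw [setIntegral_const, setIntegral_indicator (hErr n), setIntegral_const, smul_eq_mul,
      smul_eq_mul, mul_one, mul_comm, inter_comm]
    exact hlow n B hB
  have hmean : ∀ n, ∫ ω, e n ω ∂P = P.real (Err n) := fun n => by
    rw [integral_condExp (hm n), integral_indicator_const _ (hErr n), smul_eq_mul, mul_one]
  have hgeR : ∀ n, b ≤ P.real (Err n) := fun n => by
    have := hlow n univ MeasurableSet.univ
    simpa using this
  have hlim : Tendsto (fun n => P.real (Err n)) atTop (𝓝 b) := by
    refine tendsto_order.2 ⟨fun c hc => Eventually.of_forall fun n => hc.trans_le (hgeR n),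
      fun c hc => ?_⟩
    filter_upwards [h ((c - b) / 2) (by linarith)] with n hn
    rw [measureReal_def, hErrP]
    refine (ENNReal.toReal_le_of_le_ofReal (by linarith) hn).trans_lt (by linarith)
  have key : TendstoInMeasure P e atTop fun _ => b := by
    refine tendstoInMeasure_of_tendsto_eLpNorm one_ne_zero (fun n => (hei n).1)
      aestronglyMeasurable_const ?_
    have heq : ∀ n, eLpNorm (e n - fun _ => b) 1 P = ENNReal.ofReal (P.real (Err n) - b) := by
      intro n
      rw [eLpNorm_one_eq_lintegral_enorm,
        ← ofReal_integral_norm_eq_lintegral_enorm ((hei n).sub (integrable_const b))]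
      congr 1
      rw [← hmean n]
      calc ∫ ω, ‖e n ω - b‖ ∂P = ∫ ω, (e n ω - b) ∂P := by
            refine integral_congr_ae ?_
            filter_upwards [hge n] with ω hω
            exact Real.norm_of_nonneg (sub_nonneg.2 hω)
        _ = ∫ ω, e n ω ∂P - b := by rw [integral_sub (hei n) (integrable_const b)]; simp
    simp_rw [heq]
    have := ENNReal.tendsto_ofReal (hlim.sub_const b)
    rwa [sub_self, ENNReal.ofReal_zero] at this
  exact key

end Consistency

/-! ### Consistency of the nearest-neighbour rule -/

section Rule

variable {E : Type u} [NormedAddCommGroup E] [NormedSpace ℝ E] [FiniteDimensional ℝ E]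
  [MeasurableSpace E] [BorelSpace E]

/-- Since the bound on the `L¹` error is uniform in the distance and in the (almost surely distinct)
tie-breakers, it can be integrated over the auxiliary variable. -/
theorem isUniversallyConsistent_knnRule {r ε : ℝ} {δ : ℝ → ℝ} (hr : 0 < r)
    (hε : 0 < ε) (hδ : ∀ a > 0, 0 < δ a) {k : ℕ → ℕ} (hk : Tendsto k atTop atTop)
    (hkn : Tendsto (fun n : ℕ => (k n : ℝ) / (n : ℝ)) atTop (𝓝 0))
    {T : ℕ → Type v} [∀ n, MeasurableSpace (T n)] {τ : ∀ n, Measure (T n)} {ρ : ∀ n, T n → E → ℝ}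
    (hρ : IsRandomSequenceIn {ρ : E → ℝ | IsConeMonotone r ε δ ρ} τ ρ) :
    IsUniversallyConsistent.{u, v, w} (knnAuxLaw τ) (knnRule k ρ) := by
  have hτ := hρ.isProbabilityMeasure
  have hI : IsProbabilityMeasure ((volume : Measure ℝ).restrict (Icc 0 1)) := ⟨by simp⟩
  have hν : ∀ n, IsProbabilityMeasure (knnAuxLaw τ n) := fun n => by
    unfold knnAuxLaw; infer_instance
  have hL : ∀ n, Measurable fun p : (Fin n → E × Fin 2) × ((Fin n → ℝ) × T n) × E =>
      knnRule k ρ n p.1 p.2.1 p.2.2 := fun n =>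
    measurable_knnClassify (ρ := fun p : (Fin n → E × Fin 2) × ((Fin n → ℝ) × T n) × E =>
        ρ n p.2.1.2) ((hρ.measurable n).comp
        (measurable_fst.snd.fst.snd.prodMk measurable_snd)) measurable_fst measurable_snd.fst.fst
      measurable_snd.snd (k n)
  refine ⟨hL, fun μ hμ => isConsistent_of_forall_eventually_le hL fun κ hκ => ?_⟩
  have hk0 : ∀ᶠ n in atTop, 0 < k n := hk.eventually_gt_atTop 0
  have hkn' : ∀ᶠ n : ℕ in atTop, k n ≤ n := by
    filter_upwards [hkn.eventually_lt_const one_pos, eventually_gt_atTop 0] with n hn hn0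
    rw [div_lt_one (Nat.cast_pos.2 hn0)] at hn
    exact_mod_cast hn.le
  filter_upwards [hk0, hkn', eventually_integral_abs_knnEstimate_sub_le μ hr hε hδ hk hkn
    (half_pos hκ)] with n hkpos hkn hest
  have hS : MeasurableSet {a : ((Fin n → ℝ) × T n) × (Fin n → E × Fin 2) × E × Fin 2 |
      knnRule k ρ n a.2.1 a.1 a.2.2.1 ≠ a.2.2.2} :=
    (measurableSet_eq_fun ((hL n).comp (measurable_snd.fst.prodMk
      (measurable_fst.prodMk measurable_snd.snd.fst))) measurable_snd.snd.snd).compl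
  have hinj : ∀ᵐ a ∂(knnAuxLaw τ n), Function.Injective a.1 :=
    Measure.quasiMeasurePreserving_fst.ae (ae_injective_pi _)
  rw [Measure.prod_apply hS]
  calc _ ≤ ∫⁻ _, ENNReal.ofReal (bayesError μ + κ) ∂(knnAuxLaw τ n) := lintegral_mono_ae ?_
    _ = _ := by simp
  filter_upwards [hinj] with a hU
  obtain ⟨U, t⟩ := a
  have hρm : Measurable (ρ n t) := (hρ.measurable n).comp measurable_prodMk_left
  have hestm : Measurable fun p : (Fin n → E × Fin 2) × (E × Fin 2) =>
      knnEstimate (ρ n t) (k n) p.1 U p.2.1 :=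
    measurable_knnEstimate (ρ := fun _ => ρ n t) (hρm.comp measurable_snd) measurable_fst
      measurable_const measurable_snd.fst (k n)
  have hint : Integrable (fun p : (Fin n → E × Fin 2) × (E × Fin 2) =>
      |knnEstimate (ρ n t) (k n) p.1 U p.2.1 - regression μ p.2.1|)
      ((Measure.pi fun _ => μ).prod μ) := by
    refine integrable_of_abs_le
      (hestm.sub ((measurable_regression μ).comp measurable_snd.fst)).abs (C := 1) fun p => ?_
    have h1 := knnEstimate_mem_Icc (ρ n t) hkpos hkn p.1 hU p.2.1
    have h2 := regression_nonneg μ p.2.1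
    have h3 := regression_le_one μ p.2.1
    rw [abs_abs]
    exact abs_le.2 ⟨by linarith [h1.1], by linarith [h1.2]⟩
  have hb := bayesError_nonneg μ
  rw [Measure.prod_apply (measurable_prodMk_left hS)]
  calc _ ≤ ∫⁻ D, ENNReal.ofReal (bayesError μ +
          2 * ∫ q, |knnEstimate (ρ n t) (k n) D U q.1 - regression μ q.1| ∂μ)
          ∂(Measure.pi fun _ : Fin n => μ) := by
        refine lintegral_mono fun D => ?_
        rw [← ENNReal.ofReal_toReal (measure_ne_top μ _)]
        refine ENNReal.ofReal_le_ofReal (measureReal_plugIn_ne_le μ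
          (f := knnEstimate (ρ n t) (k n) D U) ?_ (C := 1) fun x => ?_)
        · exact measurable_knnEstimate (ρ := fun _ => ρ n t) (hρm.comp measurable_snd)
            measurable_const measurable_const measurable_id (k n)
        · have := knnEstimate_mem_Icc (ρ n t) hkpos hkn D hU x
          rw [abs_of_nonneg this.1]
          exact this.2
    _ = ENNReal.ofReal (∫ D, (bayesError μ +
          2 * ∫ q, |knnEstimate (ρ n t) (k n) D U q.1 - regression μ q.1| ∂μ)
          ∂(Measure.pi fun _ : Fin n => μ)) := by
        refine (ofReal_integral_eq_lintegral_ofReal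
          ((integrable_const _).add (hint.integral_prod_left.const_mul 2))
          (ae_of_all _ fun D => ?_)).symm
        exact add_nonneg hb (mul_nonneg zero_le_two (integral_nonneg fun q => abs_nonneg _))
    _ ≤ ENNReal.ofReal (bayesError μ + κ) := by
        refine ENNReal.ofReal_le_ofReal ?_
        rw [integral_add (integrable_const _) (hint.integral_prod_left.const_mul 2),
          integral_const_mul, ← integral_prod _ hint]
        have := hest (ρ n t) hρm (hρ.mem n t) U hU
        simp only [integral_const, probReal_univ, one_smul]
        linarith

end Rule

theorem mainTheorem2 {E : Type u} [NormedAddCommGroup E] [NormedSpace ℝ E] [FiniteDimensional ℝ E]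
    [MeasurableSpace E] [BorelSpace E]
    (α β γ r : ℝ) (hα : 0 ≤ α) (hβ : 0 < β) (hγ : 0 < γ) (hr : 0 < r)
    (𝓕 : Set (E → ℝ)) (h𝓕 : ∀ ρ ∈ 𝓕, IsLocallyLipschitzDistance α β γ r ρ)
    (k : ℕ → ℕ) (hk : Tendsto k atTop atTop)
    (hkn : Tendsto (fun n : ℕ => (k n : ℝ) / (n : ℝ)) atTop (𝓝 0)) :
    (∀ (T : ℕ → Type v) [∀ n, MeasurableSpace (T n)] (τ : ∀ n, Measure (T n))
      (ρ : ∀ n, T n → E → ℝ), IsRandomSequenceIn 𝓕 τ ρ →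
      IsUniversallyConsistent.{u, v, w} (knnAuxLaw τ) (knnRule k ρ)) ∧
    (∀ 𝓖 : Set (E → ℝ),
      (∀ g ∈ 𝓖, ∃ f ∈ 𝓕, ∃ h : ℝ → ℝ, StrictMonoOn h (range f) ∧ g = h ∘ f) →
      ∀ (T : ℕ → Type v) [∀ n, MeasurableSpace (T n)] (τ : ∀ n, Measure (T n))
        (ρ : ∀ n, T n → E → ℝ), IsRandomSequenceIn 𝓖 τ ρ →
        IsUniversallyConsistent.{u, v, w} (knnAuxLaw τ) (knnRule k ρ)) := by
  have hε : 0 < min 1 (β / (α + 1)) := by positivity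
  have hδ : ∀ a > 0, 0 < min r (min (β * a) γ / (α + 1)) := fun a ha => by positivity
  refine ⟨fun T _ τ ρ hρ => ?_, fun 𝓖 h𝓖 T _ τ ρ hρ => ?_⟩
  · exact isUniversallyConsistent_knnRule hr hε hδ hk hkn ⟨hρ.isProbabilityMeasure, hρ.measurable,
      fun n t => (h𝓕 _ (hρ.mem n t)).isConeMonotone hα hβ⟩
  · refine isUniversallyConsistent_knnRule hr hε hδ hk hkn ⟨hρ.isProbabilityMeasure, hρ.measurable,
      fun n t => ?_⟩
    obtain ⟨f, hf, h, hh, hg⟩ := h𝓖 _ (hρ.mem n t)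
    change IsConeMonotone _ _ _ (ρ n t)
    rw [hg]
    exact ((h𝓕 f hf).isConeMonotone hα hβ).comp hh
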